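/- **Setting.** Fix $\alpha>1$ and an integer $D\ge 1$. A workload vector is a family $w=(w_i)_{i\in\mathbb Z}$ of reals $w_i\ge 0$; the work $w_i$ is released at time $i$ and has to be processed within $[i,i+D]$. A feasible schedule $s$ for $(w,D)$ consists of measurable speed functions $s_i:\mathbb R\to[0,\infty)$ vanishing outside $[i,i+D]$ with $\int_i^{i+D}s_i(t)\,dt=w_i$; its cost is $\int_{\mathbb R}\big(\sum_i s_i(t)\big)^\alpha dt$, and $\mathrm{OPT}$ is the infimum of the costs of feasible schedules of $(w,D)$. The same definitions are used for real durations $D'>0$. $\mathrm{AVR}$ processes $w_i$ at speed $w_i/D$ during $[i,i+D]$. **Predictions.** Let $w=w^{\mathrm{real}}$. At each integral time $t$, when the $w_i$ with $i\le t$ are already known, a predicted workload vector $w^{\mathrm{pred}}(t)$ for the times $i>t$ is received. For $0<\lambda<1$ put $$\mathrm{err}^{(\lambda)}=\sum_{t\in\mathbb Z}\ \sum_{i=t+1}^{\infty}\big|w^{\mathrm{real}}_i-w^{\mathrm{pred}}_i(t)\big|^\alpha\,\lambda^{i-t}\in[0,\infty].$$ **LAS with robustness parameter $\delta\in(0,1)$**,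 on real workload $w$ and predicted workload $u$ with finitely many jobs: put $D'=(1-\delta)D$ and compute an optimal schedule of $u$ for the duration $D'$ that runs each $u_i$ at a uniform speed $c_i=u_i/(b_i-a_i)$ in an interval $[a_i,b_i]$, these intervals being non-overlapping ($c_i=0$ if $u_i=0$). Let $s'_i(t)=\min\{w_i/(b_i-a_i),c_i\}$ for $t\in[a_i,b_i]$ and $s''_i(t)=\max\{0,w_i-u_i\}/D'$ for $t\in[i,i+D']$ (both $0$ elsewhere). LAS outputs $s_i(t)=\frac1{\delta D}\int_{t-\delta D}^{t}\big(s'_i(r)+s''_i(r)\big)\,dr$. **Splitting algorithm with parameters $\delta$ and $k\ge1$.** Choose $x\in\{0,\dots,k-1\}$ uniformly at random and let $I_m=[t_m,t_{m+1})$ with $t_m=2((m-1)k-x)D$, $m\in\mathbb Z$. For each $m$, the jobs $i$ with $[i,i+D]\subseteq I_m$ are scheduled by LAS with parameter $\delta$, using as prediction for these jobs the vector $w^{\mathrm{pred}}(t_m)$ (with the already revealed true value for a job released at time $t_m$ itself). The jobs whose window $[i,i+D]$ meets both $I_m$ and $I_{m+1}$ are scheduled by $\mathrm{AVR}$. The speeds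 are added. **Theorem.** There is an absolute constant $C>0$ such that for all $\alpha>1$ and $0<\varepsilon\le1$ there are $\delta\in(0,1)$ with $\frac{\varepsilon}{C\alpha}\le\delta\le\frac{C\varepsilon}{\alpha}$ and an integer $k\ge1$, both depending only on $\alpha$ and $\varepsilon$, such that for every integer $D\ge1$ the following holds. Optimal schedules of the normalized form used by LAS always exist. Whichever of them are used, for every workload vector $w^{\mathrm{real}}$ and all predictions $w^{\mathrm{pred}}(t)$, the splitting algorithm always outputs a feasible schedule of $(w^{\mathrm{real}},D)$, and for every $0<\lambda<1$ its expected cost is at most $$(1+\varepsilon)\,\mathrm{OPT}+\Big(\frac{C\alpha}{\varepsilon}\Big)^{\alpha}\,\lambda^{-\frac D\varepsilon\left(\frac{C\alpha}{\varepsilon}\right)^{\alpha}}\,\mathrm{err}^{(\lambda)} .$$ -/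

import Mathlib

open scoped ENNReal NNReal

namespace SpeedScaling

noncomputable section

/-- A workload vector: `w i` is the total work of the jobs released at the integral time `i`.
The timeline is infinite in both directions; an instance with a finite horizon is one whose
workload vanishes outside the horizon. -/
abbrev Workload := ℤ → ℝ≥0

/-- A schedule: `s i t` is the speed at which the workload released at time `i` is processed
at time `t`. -/
abbrev Schedule := ℤ → ℝ → ℝ≥0∞

/-- Feasibility of `s` for the workload `w` with (real) duration `D`: the workload released at
time `i` is processed only during `[i, i + D]`, at finite speed, and it is completed there. -/
structure Feasible (D : ℝ) (w : Workload) (s : Schedule) : Prop where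
  measurable : ∀ i, Measurable (s i)
  finite : ∀ i t, s i t ≠ ∞
  window : ∀ (i : ℤ) (t : ℝ), t ∉ Set.Icc (i : ℝ) (i + D) → s i t = 0
  work : ∀ i : ℤ, ∫⁻ t in Set.Icc (i : ℝ) (i + D), s i t = w i

/-- The energy `∫ (∑ i, s i t) ^ α dt`. -/
def cost (α : ℝ) (s : Schedule) : ℝ≥0∞ := ∫⁻ t : ℝ, (∑' i, s i t) ^ α

/-- The offline optimum. -/
def OPT (α D : ℝ) (w : Workload) : ℝ≥0∞ := ⨅ (s : Schedule) (_ : Feasible D w s), cost α s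

/-- The Average Rate heuristic: `w i` is processed at speed `w i / D` throughout `[i, i + D]`. -/
def avr (D : ℝ) (w : Workload) : Schedule := fun i =>
  (Set.Icc (i : ℝ) (i + D)).indicator fun _ => (w i : ℝ≥0∞) / ENNReal.ofReal D

/-- Endpoints of execution intervals: `w i` is to be processed during `[(I i).1, (I i).2]`. -/
abbrev Intervals := ℤ → ℝ × ℝ

/-- The schedule that runs each `u i` at the uniform speed `c i = u i / (b i - a i)` during
`[a i, b i]`. -/
def uniformSchedule (u : Workload) (I : Intervals) : Schedule := fun i =>
  (Set.Icc (I i).1 (I i).2).indicator fun _ => (u i : ℝ≥0∞) / ENNReal.ofReal ((I i).2 - (I i).1)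

/-- The intervals `I` describe a normalized optimal schedule of `u` with duration `D`: the
intervals do not overlap, and running each `u i` uniformly in its interval is feasible and has
optimal cost. -/
structure IsNormalizedOptimal (α D : ℝ) (u : Workload) (I : Intervals) : Prop where
  le : ∀ i, (I i).1 ≤ (I i).2
  nonoverlapping : ∀ i j, i ≠ j →
    Disjoint (Set.Ioo (I i).1 (I i).2) (Set.Ioo (I j).1 (I j).2)
  feasible : Feasible D u (uniformSchedule u I)
  optimal : cost α (uniformSchedule u I) = OPT α D u

/-- An offline solver for duration `D`: it computes a normalized optimal schedule of each
workload with finitely many jobs. -/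
def IsOfflineSolver (α D : ℝ) (solver : Workload → Intervals) : Prop :=
  ∀ u : Workload, u.support.Finite → IsNormalizedOptimal α D u (solver u)

/-- LAS-Trust with duration `D`, true workload `w`, predicted workload `u` and intervals
`[a i, b i]` of a normalized optimal schedule of `u`, run there with speeds `c i`:
`w i` is processed in `[a i, b i]` at speed `min (w i / (b i - a i)) (c i)`, and the excess
`max 0 (w i - u i)` is spread uniformly over `[i, i + D]`. -/
def lasTrust (D : ℝ) (w u : Workload) (I : Intervals) : Schedule := fun i t =>
  (Set.Icc (I i).1 (I i).2).indicator
    (fun _ => min ((w i : ℝ≥0∞) / ENNReal.ofReal ((I i).2 - (I i).1))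
      ((u i : ℝ≥0∞) / ENNReal.ofReal ((I i).2 - (I i).1))) t
  + (Set.Icc (i : ℝ) (i + D)).indicator
    (fun _ => ((w i - u i : ℝ≥0) : ℝ≥0∞) / ENNReal.ofReal D) t

/-- The convolution `s^(δ)`, which averages each speed function over the last `δ * D` time
units. -/
def robustify (δ D : ℝ) (s : Schedule) : Schedule := fun i t =>
  (∫⁻ r in Set.Ioc (t - δ * D) t, s i r) / ENNReal.ofReal (δ * D)

/-- The algorithm LAS with robustness parameter `δ`: run LAS-Trust with the shortened duration
`(1 - δ) * D` and robustify the result. -/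
def las (solver : Workload → Intervals) (δ D : ℝ) (w u : Workload) : Schedule :=
  robustify δ D (lasTrust ((1 - δ) * D) w u (solver u))

/-- The workload `w` restricted to the jobs released at a time in `S`. -/
def restrict (S : Set ℤ) (w : Workload) : Workload := S.indicator w

/-- The start `2 * ((m - 1) * k - x) * D` of the `m`-th interval. The `m`-th interval is
`[blockStart D k x m, blockStart D k x (m + 1))`, of length `2 * k * D`. -/
def blockStart (D k x : ℕ) (m : ℤ) : ℤ := 2 * ((m - 1) * k - x) * D

/-- Release times `j` of the jobs whose window `[j, j + D]` is contained in the `m`-th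
interval. -/
def innerJobs (D k x : ℕ) (m : ℤ) : Set ℤ :=
  {j | blockStart D k x m ≤ j ∧ j + D < blockStart D k x (m + 1)}

/-- Release times `j` of the jobs whose window `[j, j + D]` overlaps both the `m`-th and the
`(m + 1)`-st interval. -/
def boundaryJobs (D k x : ℕ) (m : ℤ) : Set ℤ :=
  {j | j < blockStart D k x (m + 1) ∧ blockStart D k x (m + 1) ≤ j + D}

/-- What is known or predicted at time `t`: workloads released up to time `t` have been revealed;
the later ones are predicted by the vector `pred t` received at time `t`. -/
def knowledge (w : Workload) (pred : ℤ → Workload) (t : ℤ) : Workload := fun i =>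
  if i ≤ t then w i else pred t i

/-- The schedule `s^ALG(m)`: LAS on the jobs contained in the `m`-th interval, with the most recent
prediction as of the start of this interval. -/
def algBlock (solver : Workload → Intervals) (δ : ℝ) (D k x : ℕ) (w : Workload)
    (pred : ℤ → Workload) (m : ℤ) : Schedule :=
  las solver δ D (restrict (innerJobs D k x m) w)
    (restrict (innerJobs D k x m) (knowledge w pred (blockStart D k x m)))

/-- The schedule `s^AVR(m)`: Average Rate on the jobs overlapping two consecutive intervals. -/
def avrBlock (D k x : ℕ) (w : Workload) (m : ℤ) : Schedule :=
  avr D (restrict (boundaryJobs D k x m) w)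

/-- The schedule of the splitting algorithm with offset `x`. -/
def splitting (solver : Workload → Intervals) (δ : ℝ) (D k x : ℕ) (w : Workload)
    (pred : ℤ → Workload) : Schedule := fun i t =>
  ∑' m : ℤ, (algBlock solver δ D k x w pred m i t + avrBlock D k x w m i t)

/-- Expected cost of the splitting algorithm, the offset `x` being uniform in `{0, …, k - 1}`. -/
def expectedCost (α : ℝ) (solver : Workload → Intervals) (δ : ℝ) (D k : ℕ) (w : Workload)
    (pred : ℤ → Workload) : ℝ≥0∞ :=
  (∑ x ∈ Finset.range k, cost α (splitting solver δ D k x w pred)) / k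

/-- The decayed error `∑_t ∑_{i > t} |w i - pred t i| ^ α * lam ^ (i - t)`. -/
def evolvingError (α lam : ℝ) (w : Workload) (pred : ℤ → Workload) : ℝ≥0∞ :=
  ∑' (t : ℤ) (i : Set.Ioi t),
    ENNReal.ofReal (|(w i : ℝ) - pred t i| ^ α * lam ^ ((i : ℤ) - t))

end

end SpeedScaling

namespace SpeedScaling

open MeasureTheory Set

/-! ### Power inequalities in `ℝ≥0∞` -/

/-! Every loss comes from splitting a total speed into a main part and a remainder by `add_rpow_le`
with one weight, θ = δ. The main part is charged P = (1 - δ)^(1 - α), the remainder Q = δ^(1 - α).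
For δ = ε / (16α), P is 1 + O(ε) and may be paid a fixed number of times. Q can be of order
(16α/ε)^(α - 1), so it may only multiply prediction errors or terms that are divided by k.

For LAS (`cost_las_le`) the final averaging costs nothing, by Jensen. A factor P is paid for
shortening the windows (`OPT_shorten_le`), one for passing from the optimum of the prediction to
that of the true workload (`OPT_le_of_error`), and one for separating the excess work, which is run
by Average Rate. The last two also produce the error terms.

For the splitting algorithm the blocks occupy disjoint times, so their costs add up, while the
optimum is superadditive over disjoint sets of jobs (`tsum_OPT_restrict_le`). One more factor P
separates the boundary jobs. A job is a boundary job for at most one offset x, so the k boundary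
costs together are at most the cost of Average Rate on all jobs, hence at most 2^α OPT
(`sum_cost_boundary_le`); averaging over x divides this by k. A prediction is used at most 2kD steps
ahead, so undoing the decay costs at most lam^(-2kD) (`tsum_block_error_le`). -/

/-- Weighted convexity of `x ↦ x ^ α`, solved for the sum. -/
theorem add_rpow_le {α θ : ℝ} (hα : 1 < α) (h0 : 0 < θ) (h1 : θ < 1) (a b : ℝ≥0∞) :
    (a + b) ^ α ≤ ENNReal.ofReal ((1 - θ) ^ (1 - α)) * a ^ α +
      ENNReal.ofReal (θ ^ (1 - α)) * b ^ α := by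
  have key : ∀ {v : ℝ}, 0 < v → ∀ c : ℝ≥0∞,
      -- Each summand is written as a weight times a rescaled value, so that Jensen with weights 1 -
      -- θ and θ applies.
      ENNReal.ofReal v * (c / ENNReal.ofReal v) = c ∧
      ENNReal.ofReal v * (c / ENNReal.ofReal v) ^ α = ENNReal.ofReal (v ^ (1 - α)) * c ^ α := by
    intro v hv c
    have hv0 : ENNReal.ofReal v ≠ 0 := by simpa using hv
    refine ⟨ENNReal.mul_div_cancel hv0 ENNReal.ofReal_ne_top, ?_⟩
    rw [ENNReal.div_rpow_of_nonneg _ _ (by linarith), ← ENNReal.ofReal_rpow_of_pos hv,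
      ENNReal.rpow_sub _ _ hv0 ENNReal.ofReal_ne_top, ENNReal.rpow_one, div_eq_mul_inv,
      div_eq_mul_inv]
    ring
  have h := ENNReal.rpow_arith_mean_le_arith_mean2_rpow (ENNReal.ofReal (1 - θ))
    (ENNReal.ofReal θ) (a / ENNReal.ofReal (1 - θ)) (b / ENNReal.ofReal θ)
    (by rw [← ENNReal.ofReal_add (by linarith) h0.le]; simp) hα.le
  rwa [(key (sub_pos.2 h1) a).1, (key h0 b).1, (key (sub_pos.2 h1) a).2, (key h0 b).2] at h

/-- Superadditivity of `x ↦ x ^ α` for `1 ≤ α`. -/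
theorem tsum_rpow_le_rpow_tsum {ι : Type*} {α : ℝ} (hα : 1 ≤ α) (x : ι → ℝ≥0∞) :
    ∑' i, x i ^ α ≤ (∑' i, x i) ^ α := by
  -- One factor of each term is kept; in the power α - 1 the term is bounded by the whole sum.
  have h : ∀ y : ℝ≥0∞, y ^ α = y * y ^ (α - 1) := fun y => by
    conv_lhs => rw [show α = 1 + (α - 1) by ring]
    rw [ENNReal.rpow_add_of_nonneg _ _ zero_le_one (by linarith), ENNReal.rpow_one]
  rw [h (∑' i, x i), ← ENNReal.tsum_mul_right]
  refine ENNReal.tsum_le_tsum fun i => ?_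
  rw [h]
  exact mul_le_mul_right (ENNReal.rpow_le_rpow (ENNReal.le_tsum i) (by linarith)) _

/-- Powers commute with sums that have at most one nonzero term. -/
theorem rpow_tsum_of_subsingleton {ι : Type*} {α : ℝ} (hα : 0 < α) (x : ι → ℝ≥0∞)
    (hx : ∀ i j, x i ≠ 0 → x j ≠ 0 → i = j) : (∑' i, x i) ^ α = ∑' i, x i ^ α := by
  by_cases h : ∃ i, x i ≠ 0
  · obtain ⟨i, hi⟩ := h
    have h0 : ∀ j, j ≠ i → x j = 0 := fun j hj => by
      by_contra hne
      exact hj (hx j i hne hi)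
    rw [tsum_eq_single i h0, tsum_eq_single i fun j hj => by simp [h0 j hj, hα]]
  · push Not at h
    simp [h, hα]

/-- Hölder's inequality against the constant function. -/
theorem rpow_setLIntegral_le {β : Type*} [MeasurableSpace β] {μ : Measure β} {α : ℝ}
    (hα : 1 < α) (A : Set β) {f : β → ℝ≥0∞} (hf : AEMeasurable f (μ.restrict A)) :
    (∫⁻ x in A, f x ∂μ) ^ α ≤ μ A ^ (α - 1) * ∫⁻ x in A, f x ^ α ∂μ := by
  have hα0 : 0 < α := by linarith
  have hpq := Real.HolderConjugate.conjExponent hα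
  have h := ENNReal.lintegral_mul_le_Lp_mul_Lq (μ.restrict A) hpq hf
    (g := fun _ => 1) aemeasurable_const
  simp only [Pi.mul_apply, mul_one, ENNReal.one_rpow, lintegral_const, one_mul,
    Measure.restrict_apply_univ] at h
  have h2 := ENNReal.rpow_le_rpow h hα0.le
  rw [ENNReal.mul_rpow_of_nonneg _ _ hα0.le, ← ENNReal.rpow_mul, ← ENNReal.rpow_mul,
    one_div_mul_cancel hα0.ne', ENNReal.rpow_one] at h2
  have he : 1 / α.conjExponent * α = α - 1 := by
    rw [Real.conjExponent]
    have : α - 1 ≠ 0 := by linarith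
    field_simp
  rw [he, mul_comm] at h2
  exact h2

/-- Jensen's inequality for averages. -/
theorem rpow_average_le {α c : ℝ} (hα : 1 < α) (hc : 0 < c) {A : Set ℝ}
    (hA : volume A = ENNReal.ofReal c) {f : ℝ → ℝ≥0∞} (hf : Measurable f) :
    ((∫⁻ x in A, f x) / ENNReal.ofReal c) ^ α ≤ (∫⁻ x in A, f x ^ α) / ENNReal.ofReal c := by
  have hc0 : ENNReal.ofReal c ≠ 0 := by simpa using hc
  rw [ENNReal.div_rpow_of_nonneg _ _ (by linarith)]
  calc (∫⁻ x in A, f x) ^ α / ENNReal.ofReal c ^ α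
      ≤ (ENNReal.ofReal c ^ (α - 1) * ∫⁻ x in A, f x ^ α) / ENNReal.ofReal c ^ α := by
        gcongr
        rw [← hA]
        exact rpow_setLIntegral_le hα A hf.aemeasurable
    _ = (∫⁻ x in A, f x ^ α) * (ENNReal.ofReal c ^ (α - 1) * ENNReal.ofReal c ^ (-α)) := by
        rw [div_eq_mul_inv, ENNReal.rpow_neg]; ring
    _ = _ := by
        rw [← ENNReal.rpow_add _ _ hc0 ENNReal.ofReal_ne_top, div_eq_mul_inv,
          ← ENNReal.rpow_neg_one]
        congr 2; ring

/-! ### Sliding windows -/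

theorem measurable_window_indicator (p q : ℝ) {f : ℝ → ℝ≥0∞} (hf : Measurable f) :
    Measurable fun z : ℝ × ℝ => (Icc (z.1 - p) (z.1 + q)).indicator f z.2 := by
  have hS : MeasurableSet {z : ℝ × ℝ | z.2 ∈ Icc (z.1 - p) (z.1 + q)} :=
    (measurableSet_le (measurable_fst.sub_const p) measurable_snd).inter
      (measurableSet_le measurable_snd (measurable_fst.add_const q))
  exact (hf.comp measurable_snd).indicator hS

theorem measurable_setLIntegral_window (p q : ℝ) {f : ℝ → ℝ≥0∞} (hf : Measurable f) :
    Measurable fun t : ℝ => ∫⁻ r in Icc (t - p) (t + q), f r := by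
  simp_rw [← lintegral_indicator measurableSet_Icc]
  exact (measurable_window_indicator p q hf).lintegral_prod_right'

/-- Tonelli: the point r lies in the window of t exactly when t is in [r - q, r + p], a set of
length p + q. -/
theorem lintegral_setLIntegral_window (p q : ℝ) {f : ℝ → ℝ≥0∞} (hf : Measurable f) :
    ∫⁻ t : ℝ, ∫⁻ r in Icc (t - p) (t + q), f r = ENNReal.ofReal (p + q) * ∫⁻ r, f r := by
  simp_rw [← lintegral_indicator measurableSet_Icc]
  rw [lintegral_lintegral_swap (measurable_window_indicator p q hf).aemeasurable,
    ← lintegral_const_mul _ hf]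
  congr 1 with r
  have : ∀ t : ℝ, (Icc (t - p) (t + q)).indicator f r
      = (Icc (r - q) (r + p)).indicator (fun _ => f r) t := by
    intro t
    simp only [indicator, mem_Icc]
    congr 1
    apply propext
    constructor <;> rintro ⟨h1, h2⟩ <;> constructor <;> linarith
  simp_rw [this]
  rw [lintegral_indicator_const measurableSet_Icc, Real.volume_Icc, mul_comm]
  congr 2; ring

/-- Averaging over a sliding window does not increase the energy. -/
theorem lintegral_rpow_window_le {α p q : ℝ} (hα : 1 < α) (hpq : 0 < p + q) {f : ℝ → ℝ≥0∞}
    (hf : Measurable f) :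
    ∫⁻ t : ℝ, ((∫⁻ r in Icc (t - p) (t + q), f r) / ENNReal.ofReal (p + q)) ^ α
      ≤ ∫⁻ t, f t ^ α := by
  have hc0 : ENNReal.ofReal (p + q) ≠ 0 := by simpa using hpq
  calc _ ≤ ∫⁻ t : ℝ, (∫⁻ r in Icc (t - p) (t + q), f r ^ α) / ENNReal.ofReal (p + q) := by
        refine lintegral_mono fun t => rpow_average_le hα hpq ?_ hf
        rw [Real.volume_Icc]; congr 1; ring
    _ = _ := by
        simp_rw [div_eq_mul_inv]
        rw [lintegral_mul_const _ (measurable_setLIntegral_window p q (hf.pow_const α)),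
          lintegral_setLIntegral_window p q (hf.pow_const α), mul_comm, ← mul_assoc,
          ENNReal.inv_mul_cancel hc0 ENNReal.ofReal_ne_top, one_mul]

/-! ### Feasibility job by job, and the optimum -/

/-- Feasibility of the speed function `f` of a single job with work `v` released at time `i`. -/
structure JobFeasible (D : ℝ) (i : ℤ) (v : ℝ≥0) (f : ℝ → ℝ≥0∞) : Prop where
  measurable : Measurable f
  finite : ∀ t, f t ≠ ∞
  window : ∀ t : ℝ, t ∉ Icc (i : ℝ) (i + D) → f t = 0
  work : ∫⁻ t, f t = v

theorem setLIntegral_of_window {A : Set ℝ} (hA : MeasurableSet A) {f : ℝ → ℝ≥0∞}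
    (hf : ∀ t ∉ A, f t = 0) : ∫⁻ t in A, f t = ∫⁻ t, f t := by
  rw [← lintegral_indicator hA]
  congr 1
  exact indicator_eq_self.2 fun t ht => by_contra fun h => ht (hf t h)

theorem feasible_iff {D : ℝ} {w : Workload} {s : Schedule} :
    Feasible D w s ↔ ∀ i, JobFeasible D i (w i) (s i) := by
  constructor
  · intro h i
    refine ⟨h.measurable i, h.finite i, h.window i, ?_⟩
    rw [← setLIntegral_of_window measurableSet_Icc (h.window i), h.work i]
  · intro h
    refine ⟨fun i => (h i).measurable, fun i => (h i).finite, fun i => (h i).window, fun i => ?_⟩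
    rw [setLIntegral_of_window measurableSet_Icc (h i).window, (h i).work]

theorem OPT_le_cost {α D : ℝ} {w : Workload} {s : Schedule} (h : Feasible D w s) :
    OPT α D w ≤ cost α s := iInf₂_le s h

theorem le_OPT {α D : ℝ} {w : Workload} {c : ℝ≥0∞}
    (h : ∀ s, Feasible D w s → c ≤ cost α s) : c ≤ OPT α D w := le_iInf₂ h

/-- Bounds for all schedules pass to the optimum. -/
theorem le_mul_OPT_add {α D : ℝ} {w : Workload} {c a b : ℝ≥0∞} (ha : a ≠ 0) (ha' : a ≠ ∞)
    (h : ∀ s, Feasible D w s → c ≤ a * cost α s + b) : c ≤ a * OPT α D w + b := by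
  rw [← tsub_le_iff_right, mul_comm, ← ENNReal.div_le_iff ha ha']
  refine le_OPT fun s hs => ?_
  rw [ENNReal.div_le_iff ha ha', tsub_le_iff_right, mul_comm]
  exact h s hs

/-! ### Reduction to uniform speeds in the order of release -/

/-- Continuity of the work done up to time t lets `exists_isOrdered_le_cost` find times at which
prescribed levels are reached. -/
theorem continuous_setLIntegral_Iic {h : ℝ → ℝ≥0∞} (hm : Measurable h)
    (hfin : ∫⁻ t, h t ≠ ∞) : Continuous fun t : ℝ => ∫⁻ r in Iic t, h r := by
  have hint : Integrable (fun t => (h t).toReal) :=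
    integrable_toReal_of_lintegral_ne_top hm.aemeasurable hfin
  have hle : ∀ t : ℝ, ∫⁻ r in Iic t, h r ≠ ∞ := fun t =>
    ne_top_of_le_ne_top hfin (setLIntegral_le_lintegral _ _)
  have heq : (fun t : ℝ => ∫⁻ r in Iic t, h r) =
      fun t => ENNReal.ofReal (∫ r in Iic t, (h r).toReal) := by
    funext t
    rw [integral_toReal hm.aemeasurable (ae_lt_top hm (hle t)), ENNReal.ofReal_toReal (hle t)]
  rw [heq]
  refine ENNReal.continuous_ofReal.comp (continuous_iff_continuousAt.2 fun t => ?_)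
  exact (IntegrableOn.continuousOn_Iic_primitive_Iic (a₀ := t + 1)
    hint.integrableOn).continuousAt (Iic_mem_nhds (by linarith))

/-- The energy for processing work `v` at uniform speed during an interval. -/
noncomputable def jobCost (α : ℝ) (v : ℝ≥0) (p : ℝ × ℝ) : ℝ≥0∞ :=
  (v : ℝ≥0∞) ^ α * ENNReal.ofReal (p.2 - p.1) ^ (1 - α)

/-- Execution intervals in the order of release. -/
structure IsOrdered (D : ℝ) (u : Workload) (I : Intervals) : Prop where
  mem : ∀ i : ℤ, I i ∈ Icc (i : ℝ) (i + D) ×ˢ Icc (i : ℝ) (i + D)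
  le : ∀ i, (I i).1 ≤ (I i).2
  order : ∀ i j, i < j → u i ≠ 0 → u j ≠ 0 → (I i).2 ≤ (I j).1
  idle : ∀ i : ℤ, u i = 0 → I i = ((i : ℝ), (i : ℝ))

theorem jobCost_zero {α : ℝ} (hα : 1 < α) (p : ℝ × ℝ) : jobCost α 0 p = 0 := by
  simp [jobCost, show 0 < α by linarith]

/-- Uniform speed is the cheapest way to process a job during an interval. -/
theorem jobCost_le_setLIntegral {α a b : ℝ} (hα : 1 < α) (hab : a < b) {v : ℝ≥0}
    {f : ℝ → ℝ≥0∞} (hf : Measurable f) (hv : v ≤ ∫⁻ t in Icc a b, f t) :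
    jobCost α v (a, b) ≤ ∫⁻ t in Icc a b, f t ^ α := by
  have hc0 : ENNReal.ofReal (b - a) ≠ 0 := by simpa using hab
  calc jobCost α v (a, b)
      ≤ (ENNReal.ofReal (b - a) ^ (α - 1) * ∫⁻ t in Icc a b, f t ^ α) *
          ENNReal.ofReal (b - a) ^ (1 - α) := by
        unfold jobCost
        gcongr
        rw [← Real.volume_Icc]
        exact (ENNReal.rpow_le_rpow hv (by linarith)).trans
          (rpow_setLIntegral_le hα _ hf.aemeasurable)
    _ = (ENNReal.ofReal (b - a) ^ (α - 1) * ENNReal.ofReal (b - a) ^ (1 - α)) *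
          ∫⁻ t in Icc a b, f t ^ α := by ring
    _ = _ := by
        rw [← ENNReal.rpow_add _ _ hc0 ENNReal.ofReal_ne_top]
        simp

/-- Every feasible schedule can be replaced by uniform speeds in ordered intervals. -/
theorem exists_isOrdered_le_cost {α D : ℝ} (hα : 1 < α) (hD : 0 < D) {u : Workload}
    (hu : u.support.Finite) {s : Schedule} (hs : Feasible D u s) :
    ∃ I, IsOrdered D u I ∧ ∑' i, jobCost α (u i) (I i) ≤ cost α s := by
  classical
  rw [feasible_iff] at hs
  set F := hu.toFinset with hF
  have memF : ∀ i, i ∈ F ↔ u i ≠ 0 := fun i => by simp [hF]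
  set h : ℝ → ℝ≥0∞ := fun t => ∑ j ∈ F, s j t with hh
  have hm : Measurable h := by
    rw [hh]; exact Finset.measurable_fun_sum _ fun i _ => (hs i).measurable
  have hsum : ∀ A : Set ℝ, ∫⁻ r in A, h r = ∑ j ∈ F, ∫⁻ r in A, s j r := fun A =>
    lintegral_finsetSum _ fun i _ => (hs i).measurable
  have hfin : ∫⁻ t, h t ≠ ∞ := by
    have := hsum univ
    simp only [Measure.restrict_univ] at this
    rw [this]
    exact ENNReal.sum_ne_top.2 fun j _ => by rw [(hs j).work]; exact ENNReal.coe_ne_top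
  -- `S t` is the work done up to time t and `W i` the work released before i. Keeping the total
  -- speed but serving jobs first-in first-out, job i runs while `S` rises from `W i` to `W i + u
  -- i`.
  set S : ℝ → ℝ≥0∞ := fun t => ∫⁻ r in Iic t, h r with hS
  have hSc : Continuous S := continuous_setLIntegral_Iic hm hfin
  have hSm : Monotone S := fun a b hab => lintegral_mono_set (Iic_subset_Iic.2 hab)
  set W : ℤ → ℝ≥0∞ := fun i => ∑ j ∈ F with j < i, (u j : ℝ≥0∞) with hW
  have hWfin : ∀ i, W i ≠ ∞ := fun i => ENNReal.sum_ne_top.2 fun j _ => ENNReal.coe_ne_top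
  have hWlt : ∀ i j, i < j → u i ≠ 0 → W i + u i ≤ W j := by
    intro i j hij hi
    have : W i + u i = ∑ k ∈ insert i (F.filter (· < i)), (u k : ℝ≥0∞) := by
      rw [Finset.sum_insert (by simp), add_comm]
    rw [this]
    refine Finset.sum_le_sum_of_subset fun k hk => ?_
    simp only [Finset.mem_insert, Finset.mem_filter] at hk ⊢
    rcases hk with rfl | ⟨hk, hki⟩
    · exact ⟨(memF k).2 hi, hij⟩
    · exact ⟨hk, hki.trans hij⟩
  -- Before time i only jobs released earlier can have been processed.
  have hSi : ∀ i : ℤ, S i ≤ W i := by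
    intro i
    simp only [hS, hW, hsum, Finset.sum_filter]
    refine Finset.sum_le_sum fun j _ => ?_
    split_ifs with hji
    · exact (setLIntegral_le_lintegral _ _).trans (hs j).work.le
    · refine le_of_eq ?_
      rw [setLIntegral_congr Iio_ae_eq_Iic.symm]
      refine setLIntegral_eq_zero measurableSet_Iio fun r hr => (hs j).window r fun hr2 => ?_
      have : (i : ℝ) ≤ j := by exact_mod_cast not_lt.1 hji
      linarith [hr2.1, mem_Iio.1 hr]
  -- All durations are equal, so every job released up to i is complete by i + D.
  have hSiD : ∀ i : ℤ, u i ≠ 0 → W i + u i ≤ S (i + D) := by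
    intro i hi
    have : W i + u i = ∑ k ∈ insert i (F.filter (· < i)), (u k : ℝ≥0∞) := by
      rw [Finset.sum_insert (by simp), add_comm]
    rw [this]
    simp only [hS, hsum]
    have hsub : insert i (F.filter (· < i)) ⊆ F := by
      intro k hk
      rcases Finset.mem_insert.1 hk with rfl | hk
      · exact (memF _).2 hi
      · exact (Finset.mem_filter.1 hk).1
    refine (Finset.sum_le_sum fun j hj => ?_).trans (Finset.sum_le_sum_of_subset hsub)
    have hji : (j : ℝ) ≤ i := by
      have : j ≤ i := by
        rcases Finset.mem_insert.1 hj with rfl | hj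
        · exact le_rfl
        · exact (Finset.mem_filter.1 hj).2.le
      exact_mod_cast this
    rw [← (hs j).work, ← setLIntegral_of_window measurableSet_Icc (hs j).window]
    exact lintegral_mono_set fun t ht => (by linarith [ht.2] : t ≤ i + D)
  -- The right endpoint is the least time at which its level is reached. Any left endpoint of a
  -- later job reaches at least this level, which gives the ordering `hord`.
  have hex : ∀ i : ℤ, u i ≠ 0 → ∃ p : ℝ × ℝ, p ∈ Icc (i : ℝ) (i + D) ×ˢ Icc (i : ℝ) (i + D) ∧
      S p.1 = W i ∧ IsLeast {t | W i + u i ≤ S t} p.2 := by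
    intro i hi
    have hlt : W i < W i + u i := ENNReal.lt_add_right (hWfin i) (by simpa using hi)
    obtain ⟨a, ha, hSa⟩ := intermediate_value_Icc (by linarith : (i : ℝ) ≤ i + D)
      hSc.continuousOn ⟨hSi i, hlt.le.trans (hSiD i hi)⟩
    have hb : ∀ t ∈ {t | W i + u i ≤ S t}, (i : ℝ) ≤ t := fun t ht => by
      by_contra hlt2
      exact absurd ((hlt.trans_le ht).trans_le (hSm (not_le.1 hlt2).le)) (not_lt.2 (hSi i))
    have hcl : IsClosed {t | W i + u i ≤ S t} := isClosed_le continuous_const hSc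
    have hne : {t | W i + u i ≤ S t}.Nonempty := ⟨i + D, hSiD i hi⟩
    have hbdd : BddBelow {t | W i + u i ≤ S t} := ⟨i, hb⟩
    have hmem := hcl.csInf_mem hne hbdd
    exact ⟨(a, sInf {t | W i + u i ≤ S t}),
      ⟨ha, hb _ hmem, csInf_le hbdd (hSiD i hi)⟩, hSa, hmem, fun t ht => csInf_le hbdd ht⟩
  choose! p hp1 hp2 hp3 using hex
  have hplt : ∀ i, u i ≠ 0 → (p i).1 < (p i).2 := by
    intro i hi
    by_contra hle
    have h1 := (hp3 i hi).1.trans (hSm (not_lt.1 hle))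
    rw [hp2 i hi] at h1
    exact absurd h1 (not_le.2 (ENNReal.lt_add_right (hWfin i) (by simpa using hi)))
  have hord : ∀ i j, i < j → u i ≠ 0 → u j ≠ 0 → (p i).2 ≤ (p j).1 := by
    intro i j hij hi hj
    refine (hp3 i hi).2 ?_
    rw [mem_ofPred_eq, hp2 j hj]
    exact hWlt i j hij hi
  refine ⟨fun i => if u i = 0 then ((i : ℝ), (i : ℝ)) else p i, ⟨?_, ?_, ?_, ?_⟩, ?_⟩
  · intro i
    split_ifs with hi
    · simp [hD.le]
    · exact hp1 i hi
  · intro i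
    split_ifs with hi
    · exact le_rfl
    · exact (hplt i hi).le
  · intro i j hij hi hj
    simpa [hi, hj] using hord i j hij hi hj
  · intro i hi
    simp [hi]
  · rw [tsum_eq_sum (s := F) fun i hi => by
      rw [memF, not_not] at hi
      rw [hi]; exact jobCost_zero hα _]
    have hdisj : (F : Set ℤ).PairwiseDisjoint fun i => Ioo (p i).1 (p i).2 := by
      intro i hi j hj hij
      rcases lt_or_gt_of_ne hij with hlt | hlt
      · refine disjoint_left.2 fun t h1 h2 => ?_
        linarith [hord i j hlt ((memF i).1 hi) ((memF j).1 hj), h1.2, h2.1]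
      · refine disjoint_left.2 fun t h1 h2 => ?_
        linarith [hord j i hlt ((memF j).1 hj) ((memF i).1 hi), h1.1, h2.2]
    calc ∑ i ∈ F, jobCost α (u i) (if u i = 0 then ((i : ℝ), (i : ℝ)) else p i)
        ≤ ∑ i ∈ F, ∫⁻ t in Ioo (p i).1 (p i).2, h t ^ α := by
          refine Finset.sum_le_sum fun i hi => ?_
          rw [if_neg ((memF i).1 hi), setLIntegral_congr Ioo_ae_eq_Icc]
          refine jobCost_le_setLIntegral hα (hplt i ((memF i).1 hi)) hm ?_
          have h1 : S (p i).2 ≤ S (p i).1 + ∫⁻ t in Icc (p i).1 (p i).2, h t := by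
            refine (lintegral_mono_set fun t ht => ?_).trans (lintegral_union_le _ _ _)
            rcases le_total t (p i).1 with h | h
            · exact Or.inl h
            · exact Or.inr ⟨h, ht⟩
          have h2 := (hp3 i ((memF i).1 hi)).1.trans h1
          rw [hp2 i ((memF i).1 hi)] at h2
          exact (ENNReal.add_le_add_iff_left (hWfin i)).1 h2
      _ = ∫⁻ t in ⋃ i ∈ F, Ioo (p i).1 (p i).2, h t ^ α :=
          (lintegral_biUnion_finset hdisj (fun _ _ => measurableSet_Ioo) _).symm
      _ ≤ ∫⁻ t, h t ^ α := setLIntegral_le_lintegral _ _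
      _ ≤ cost α s := by
          refine lintegral_mono fun t => ENNReal.rpow_le_rpow ?_ (by linarith)
          exact ENNReal.sum_le_tsum F

theorem jobFeasible_zero (D : ℝ) (i : ℤ) {f : ℝ → ℝ≥0∞} (hf : ∀ t, f t = 0) :
    JobFeasible D i 0 f := by
  obtain rfl : f = fun _ => 0 := funext hf
  exact ⟨measurable_const, by simp, by simp, by simp⟩

theorem JobFeasible.add {D : ℝ} {i : ℤ} {v v' : ℝ≥0} {f g : ℝ → ℝ≥0∞}
    (hf : JobFeasible D i v f) (hg : JobFeasible D i v' g) :
    JobFeasible D i (v + v') fun t => f t + g t where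
  measurable := hf.measurable.add hg.measurable
  finite t := ENNReal.add_ne_top.2 ⟨hf.finite t, hg.finite t⟩
  window t ht := by rw [hf.window t ht, hg.window t ht, add_zero]
  work := by rw [lintegral_add_left hf.measurable, hf.work, hg.work, ENNReal.coe_add]

theorem jobFeasible_indicator {D a b : ℝ} {i : ℤ} (hab : a < b) (ha : i ≤ a) (hb : b ≤ i + D)
    (v : ℝ≥0) :
    JobFeasible D i v ((Icc a b).indicator fun _ => (v : ℝ≥0∞) / ENNReal.ofReal (b - a)) := by
  have hc0 : ENNReal.ofReal (b - a) ≠ 0 := by simpa using hab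
  refine ⟨measurable_const.indicator measurableSet_Icc, fun t => ?_, fun t ht => ?_, ?_⟩
  · refine ne_top_of_le_ne_top ?_ (indicator_le_self _ _ t)
    exact ENNReal.div_ne_top ENNReal.coe_ne_top hc0
  · exact indicator_of_notMem (fun h => ht ⟨ha.trans h.1, h.2.trans hb⟩) _
  · rw [lintegral_indicator_const measurableSet_Icc, Real.volume_Icc,
      ENNReal.div_mul_cancel hc0 ENNReal.ofReal_ne_top]

theorem lintegral_indicator_rpow {α a b : ℝ} (hα : 1 < α) (hab : a < b) (v : ℝ≥0) :
    ∫⁻ t, ((Icc a b).indicator (fun _ => (v : ℝ≥0∞) / ENNReal.ofReal (b - a)) t) ^ α =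
      jobCost α v (a, b) := by
  have hc0 : ENNReal.ofReal (b - a) ≠ 0 := by simpa using hab
  have h : ∀ t, ((Icc a b).indicator (fun _ => (v : ℝ≥0∞) / ENNReal.ofReal (b - a)) t) ^ α =
      (Icc a b).indicator (fun _ => ((v : ℝ≥0∞) / ENNReal.ofReal (b - a)) ^ α) t := by
    intro t
    by_cases ht : t ∈ Icc a b
    · simp [ht]
    · simp [ht, show 0 < α by linarith]
  simp_rw [h]
  rw [lintegral_indicator_const measurableSet_Icc, Real.volume_Icc,
    ENNReal.div_rpow_of_nonneg _ _ (by linarith), jobCost, ENNReal.rpow_sub _ _ hc0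
    ENNReal.ofReal_ne_top, ENNReal.rpow_one, div_eq_mul_inv, div_eq_mul_inv]
  ring

/-! ### Average Rate -/

theorem jobFeasible_avr {D : ℝ} (hD : 0 < D) (i : ℤ) (w : Workload) :
    JobFeasible D i (w i) (avr D w i) := by
  have := jobFeasible_indicator (D := D) (a := i) (b := i + D) (i := i) (by linarith) le_rfl
    le_rfl (w i)
  rwa [add_sub_cancel_left] at this

theorem feasible_avr {D : ℝ} (hD : 0 < D) (w : Workload) : Feasible D w (avr D w) :=
  feasible_iff.2 fun i => jobFeasible_avr hD i w

theorem lintegral_avr_rpow {α D : ℝ} (hα : 1 < α) (hD : 0 < D) (i : ℤ) (w : Workload) :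
    ∫⁻ t, avr D w i t ^ α = (w i : ℝ≥0∞) ^ α * ENNReal.ofReal D ^ (1 - α) := by
  have := lintegral_indicator_rpow hα (a := i) (b := i + D) (by linarith) (w i)
  rw [add_sub_cancel_left] at this
  simpa [avr, jobCost] using this

/-- At most `N` jobs of duration `D ≤ N` are active at a time. -/
theorem cost_avr_le {α D : ℝ} {N : ℕ} (hα : 1 < α) (hD : 0 < D) (hDN : D ≤ N) (w : Workload) :
    cost α (avr D w) ≤ (N : ℝ≥0∞) ^ (α - 1) * ENNReal.ofReal D ^ (1 - α) *
      ∑' i, (w i : ℝ≥0∞) ^ α := by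
  have hpt : ∀ᵐ t : ℝ, (∑' i, avr D w i t) ^ α ≤
      (N : ℝ≥0∞) ^ (α - 1) * ∑' i, avr D w i t ^ α := by
    -- Integral times are discarded: at such a time N + 1 closed windows of length N meet.
    have hc : (range ((↑) : ℤ → ℝ)).Countable := countable_range _
    filter_upwards [hc.ae_notMem volume] with t ht
    have h0 : ∀ i ∉ Finset.Ioc (⌊t⌋ - (N : ℤ)) ⌊t⌋, avr D w i t = 0 := by
      intro i hi
      refine indicator_of_notMem (fun hm => hi ?_) _
      have h1 : i ≤ ⌊t⌋ := Int.le_floor.2 hm.1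
      have h2 : t ≤ i + N := by linarith [hm.2]
      have h3 : (⌊t⌋ : ℝ) < t := lt_of_le_of_ne (Int.floor_le t) fun h => ht ⟨_, h⟩
      have h4 : (⌊t⌋ : ℝ) < i + N := h3.trans_le h2
      have h5 : ⌊t⌋ < i + N := by exact_mod_cast h4
      exact Finset.mem_Ioc.2 ⟨by linarith, h1⟩
    rw [tsum_eq_sum h0]
    refine (ENNReal.rpow_sum_le_const_mul_sum_rpow _ _ hα.le).trans ?_
    have hcard : (Finset.Ioc (⌊t⌋ - (N : ℤ)) ⌊t⌋).card = N := by simp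
    rw [hcard]
    gcongr
    exact ENNReal.sum_le_tsum _
  refine (lintegral_mono_ae hpt).trans (le_of_eq ?_)
  rw [lintegral_const_mul _ (Measurable.tsum fun i =>
      (jobFeasible_avr hD i w).measurable.pow_const α),
    lintegral_tsum fun i => ((jobFeasible_avr hD i w).measurable.pow_const α).aemeasurable]
  simp_rw [lintegral_avr_rpow hα hD]
  rw [ENNReal.tsum_mul_right]
  ring

/-- The speed of Average Rate is at most twice the average of any feasible speed over
`[t - D, t + D]`. -/
theorem cost_avr_le_OPT {α D : ℝ} (hα : 1 < α) (hD : 0 < D) (w : Workload) :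
    cost α (avr D w) ≤ 2 ^ α * OPT α D w := by
  have hpos : (2 : ℝ≥0∞) ^ α ≠ 0 := by simp
  have htop : (2 : ℝ≥0∞) ^ α ≠ ∞ := ENNReal.rpow_ne_top_of_nonneg (by linarith) (by simp)
  have hD0 : ENNReal.ofReal D ≠ 0 := by simpa using hD
  rw [← add_zero (_ * OPT α D w)]
  refine le_mul_OPT_add hpos htop fun s hs => ?_
  rw [add_zero]
  have hs' := feasible_iff.1 hs
  have hm : Measurable fun t => ∑' i, s i t := Measurable.tsum fun i => hs.measurable i
  have hpt : ∀ t : ℝ, ∑' i, avr D w i t ≤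
      2 * ((∫⁻ r in Icc (t - D) (t + D), ∑' i, s i r) / ENNReal.ofReal (D + D)) := by
    intro t
    have h2 : ∀ y : ℝ≥0∞, 2 * (y / ENNReal.ofReal (D + D)) = y / ENNReal.ofReal D := by
      intro y
      rw [← two_mul, ENNReal.ofReal_mul zero_le_two, ENNReal.ofReal_ofNat, ← mul_div_assoc,
        ENNReal.mul_div_mul_left _ _ two_ne_zero ENNReal.ofNat_ne_top]
    rw [h2, lintegral_tsum fun i => (hs.measurable i).aemeasurable, div_eq_mul_inv,
      ← ENNReal.tsum_mul_right]
    refine ENNReal.tsum_le_tsum fun i => ?_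
    unfold avr
    by_cases ht : t ∈ Icc (i : ℝ) (i + D)
    · rw [indicator_of_mem ht, div_eq_mul_inv]
      gcongr
      rw [← hs.work i]
      exact lintegral_mono_set (Icc_subset_Icc (by linarith [ht.2]) (by linarith [ht.1]))
    · rw [indicator_of_notMem ht]; exact zero_le
  calc cost α (avr D w)
      ≤ ∫⁻ t : ℝ, 2 ^ α *
          ((∫⁻ r in Icc (t - D) (t + D), ∑' i, s i r) / ENNReal.ofReal (D + D)) ^ α := by
        refine lintegral_mono fun t => ?_
        rw [← ENNReal.mul_rpow_of_nonneg _ _ (by linarith)]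
        exact ENNReal.rpow_le_rpow (hpt t) (by linarith)
    _ ≤ 2 ^ α * cost α s := by
        rw [lintegral_const_mul' _ _ htop]
        gcongr
        exact lintegral_rpow_window_le hα (by linarith) hm

/-! ### Normalized optimal schedules -/

/-- A degenerate interval would cost 0^(1 - α) = ∞. -/
theorem IsOrdered.lt {α D : ℝ} (hα : 1 < α) {u : Workload} {I : Intervals}
    (hI : IsOrdered D u I) (hfin : ∑' i, jobCost α (u i) (I i) ≠ ∞) (i : ℤ) (hi : u i ≠ 0) :
    (I i).1 < (I i).2 := by
  refine lt_of_le_of_ne (hI.le i) fun h => hfin ?_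
  refine top_unique (le_trans (le_of_eq ?_) (ENNReal.le_tsum i))
  rw [jobCost, h, sub_self, ENNReal.ofReal_zero, ENNReal.zero_rpow_of_neg (by linarith),
    ENNReal.mul_top]
  simp [hi]

theorem IsOrdered.nonoverlapping {D : ℝ} {u : Workload} {I : Intervals} (hI : IsOrdered D u I)
    (i j : ℤ) (hij : i ≠ j) : Disjoint (Ioo (I i).1 (I i).2) (Ioo (I j).1 (I j).2) := by
  wlog hlt : i < j generalizing i j
  · exact (this j i hij.symm (lt_of_le_of_ne (not_lt.1 hlt) hij.symm)).symm
  by_cases hi : u i = 0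
  · simp [hI.idle i hi]
  by_cases hj : u j = 0
  · simp [hI.idle j hj]
  refine disjoint_left.2 fun t h1 h2 => ?_
  linarith [hI.order i j hlt hi hj, h1.2, h2.1]

theorem IsOrdered.feasible {α D : ℝ} (hα : 1 < α) {u : Workload} {I : Intervals}
    (hI : IsOrdered D u I) (hfin : ∑' i, jobCost α (u i) (I i) ≠ ∞) :
    Feasible D u (uniformSchedule u I) := by
  refine feasible_iff.2 fun i => ?_
  by_cases hi : u i = 0
  · rw [hi]
    exact jobFeasible_zero D i fun t => by simp [uniformSchedule, hi]
  · exact jobFeasible_indicator (hI.lt hα hfin i hi) (hI.mem i).1.1 (hI.mem i).2.2 _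

/-- Away from the countably many endpoints at most one job runs, so the power of the total speed is
the sum of the powers. -/
theorem IsOrdered.cost_le {α D : ℝ} (hα : 1 < α) {u : Workload} {I : Intervals}
    (hI : IsOrdered D u I) (hfin : ∑' i, jobCost α (u i) (I i) ≠ ∞) :
    cost α (uniformSchedule u I) ≤ ∑' i, jobCost α (u i) (I i) := by
  have hpt : ∀ᵐ t : ℝ, (∑' i, uniformSchedule u I i t) ^ α =
      ∑' i, uniformSchedule u I i t ^ α := by
    have hc : (range (fun i => (I i).1) ∪ range fun i => (I i).2).Countable :=
      (countable_range _).union (countable_range _)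
    filter_upwards [hc.ae_notMem volume] with t ht
    refine rpow_tsum_of_subsingleton (by linarith) _ fun i j hi hj => ?_
    by_contra hij
    have hmem : ∀ k, uniformSchedule u I k t ≠ 0 → t ∈ Ioo (I k).1 (I k).2 := by
      intro k hk
      have := mem_of_indicator_ne_zero hk
      exact ⟨lt_of_le_of_ne this.1 fun h => ht (Or.inl ⟨k, h⟩),
        lt_of_le_of_ne this.2 fun h => ht (Or.inr ⟨k, h.symm⟩)⟩
    exact disjoint_left.1 (hI.nonoverlapping i j hij) (hmem i hi) (hmem j hj)
  rw [cost, lintegral_congr_ae hpt, lintegral_tsum fun i =>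
    (((hI.feasible hα hfin).measurable i).pow_const α).aemeasurable]
  refine ENNReal.tsum_le_tsum fun i => ?_
  by_cases hi : u i = 0
  · simp [uniformSchedule, hi, show 0 < α by linarith]
  · exact (lintegral_indicator_rpow hα (hI.lt hα hfin i hi) (u i)).le

/-- Closed conditions on a product of compact squares (Tychonoff); this supplies the minimizer in
`exists_isNormalizedOptimal`. -/
theorem isCompact_isOrdered (D : ℝ) (u : Workload) : IsCompact {I | IsOrdered D u I} := by
  have h : {I | IsOrdered D u I} =
      (univ.pi fun i : ℤ => Icc (i : ℝ) (i + D) ×ˢ Icc (i : ℝ) (i + D)) ∩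
      ({I | ∀ i, (I i).1 ≤ (I i).2} ∩
      ({I | ∀ i j, i < j → u i ≠ 0 → u j ≠ 0 → (I i).2 ≤ (I j).1} ∩
      {I | ∀ i, u i = 0 → I i = ((i : ℝ), (i : ℝ))})) := by
    ext I
    exact ⟨fun h => ⟨fun i _ => h.mem i, h.le, h.order, h.idle⟩,
      fun h => ⟨fun i => h.1 i (mem_univ i), h.2.1, h.2.2.1, h.2.2.2⟩⟩
  rw [h]
  refine (isCompact_univ_pi fun i => isCompact_Icc.prod isCompact_Icc).inter_right
    (IsClosed.inter ?_ (IsClosed.inter ?_ ?_))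
  · simp only [ofPred_forall]
    exact isClosed_iInter fun i => isClosed_le (by fun_prop) (by fun_prop)
  · simp only [ofPred_forall]
    exact isClosed_iInter fun i => isClosed_iInter fun j => isClosed_iInter fun _ =>
      isClosed_iInter fun _ => isClosed_iInter fun _ => isClosed_le (by fun_prop) (by fun_prop)
  · simp only [ofPred_forall]
    exact isClosed_iInter fun i => isClosed_iInter fun _ =>
      isClosed_eq (by fun_prop) continuous_const

theorem continuous_jobCost (α : ℝ) (hα : 0 ≤ α) (v : ℝ≥0) : Continuous (jobCost α v) := by
  unfold jobCost
  refine (ENNReal.continuous_const_mul ?_).comp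
    (ENNReal.continuous_rpow_const.comp (ENNReal.continuous_ofReal.comp (by fun_prop)))
  exact ENNReal.rpow_ne_top_of_nonneg hα ENNReal.coe_ne_top

theorem cost_avr_ne_top {α D : ℝ} (hα : 1 < α) (hD : 0 < D) {u : Workload}
    (hu : u.support.Finite) : cost α (avr D u) ≠ ∞ := by
  obtain ⟨N, hN⟩ := exists_nat_ge D
  refine ne_top_of_le_ne_top ?_ (cost_avr_le hα hD hN u)
  refine ENNReal.mul_ne_top (ENNReal.mul_ne_top ?_ ?_) ?_
  · exact ENNReal.rpow_ne_top_of_nonneg (by linarith) (ENNReal.natCast_ne_top N)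
  · rw [ENNReal.ofReal_rpow_of_pos hD]; exact ENNReal.ofReal_ne_top
  · rw [tsum_eq_sum (s := hu.toFinset) fun i hi => by
      rw [Finite.mem_toFinset, Function.mem_support, not_not] at hi
      simp [hi, show 0 < α by linarith]]
    exact ENNReal.sum_ne_top.2 fun i _ =>
      ENNReal.rpow_ne_top_of_nonneg (by linarith) ENNReal.coe_ne_top

/-- Ordered intervals of minimal total `jobCost` exist by compactness, and
`exists_isOrdered_le_cost` shows that no feasible schedule is cheaper. -/
theorem exists_isNormalizedOptimal {α D : ℝ} (hα : 1 < α) (hD : 0 < D) {u : Workload}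
    (hu : u.support.Finite) : ∃ I, IsNormalizedOptimal α D u I := by
  have hsum : ∀ I : Intervals, ∑' i, jobCost α (u i) (I i) =
      ∑ i ∈ hu.toFinset, jobCost α (u i) (I i) := fun I => tsum_eq_sum fun i hi => by
    rw [Finite.mem_toFinset, Function.mem_support, not_not] at hi
    rw [hi]; exact jobCost_zero hα _
  obtain ⟨I₀, hI₀, hc₀⟩ := exists_isOrdered_le_cost hα hD hu (feasible_avr hD u)
  obtain ⟨I, hI, hmin⟩ := (isCompact_isOrdered D u).exists_isMinOn ⟨I₀, hI₀⟩
    (f := fun I : Intervals => ∑' i, jobCost α (u i) (I i)) (by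
      simp_rw [hsum]
      exact (continuous_finsetSum _ fun i _ =>
        (continuous_jobCost α (by linarith) (u i)).comp (continuous_apply i)).continuousOn)
  have hfin : ∑' i, jobCost α (u i) (I i) ≠ ∞ :=
    ne_top_of_le_ne_top (cost_avr_ne_top hα hD hu) ((hmin hI₀).trans hc₀)
  refine ⟨I, hI.le, hI.nonoverlapping, hI.feasible hα hfin, le_antisymm ?_
    (OPT_le_cost (hI.feasible hα hfin))⟩
  refine le_OPT fun s hs => ?_
  obtain ⟨J, hJ, hcJ⟩ := exists_isOrdered_le_cost hα hD hu hs
  exact ((hI.cost_le hα hfin).trans (hmin hJ)).trans hcJ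

theorem exists_isOfflineSolver {α D : ℝ} (hα : 1 < α) (hD : 0 < D) :
    ∃ solver, IsOfflineSolver α D solver := by
  have : ∀ u : Workload, ∃ I, u.support.Finite → IsNormalizedOptimal α D u I := fun u => by
    by_cases hu : u.support.Finite
    · obtain ⟨I, hI⟩ := exists_isNormalizedOptimal hα hD hu
      exact ⟨I, fun _ => hI⟩
    · exact ⟨fun _ => 0, fun h => absurd h hu⟩
  choose f hf using this
  exact ⟨f, hf⟩

/-- Shortening the duration by a factor `1 - δ` costs at most a factor `(1 - δ) ^ (1 - α)`. -/
theorem OPT_shorten_le {α D δ : ℝ} (hα : 1 < α) (hD : 0 < D) (h0 : 0 < δ) (h1 : δ < 1)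
    {u : Workload} (hu : u.support.Finite) :
    OPT α ((1 - δ) * D) u ≤ ENNReal.ofReal ((1 - δ) ^ (1 - α)) * OPT α D u := by
  have hδ : 0 < 1 - δ := by linarith
  rw [← add_zero (_ * OPT α D u)]
  refine le_mul_OPT_add (by simpa using Real.rpow_pos_of_pos hδ _) ENNReal.ofReal_ne_top
    fun s hs => ?_
  obtain ⟨I, hI, hc⟩ := exists_isOrdered_le_cost hα hD hu hs
  -- Each interval is contracted towards its release time. The order survives because an endpoint b
  -- of job i becomes δ i + (1 - δ) b, and both i and b are monotone along the jobs. Every length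
  -- shrinks by 1 - δ.
  set J : Intervals := fun i =>
    ((i : ℝ) + (1 - δ) * ((I i).1 - i), (i : ℝ) + (1 - δ) * ((I i).2 - i)) with hJdef
  have hJ : IsOrdered ((1 - δ) * D) u J := by
    refine ⟨fun i => ?_, fun i => ?_, fun i j hij hi hj => ?_, fun i hi => ?_⟩
    · obtain ⟨⟨h1, h2⟩, h3, h4⟩ := hI.mem i
      simp only [hJdef, mem_prod, mem_Icc]
      refine ⟨⟨?_, ?_⟩, ?_, ?_⟩ <;> nlinarith
    · simp only [hJdef]
      nlinarith [hI.le i]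
    · have := hI.order i j hij hi hj
      have hij' : (i : ℝ) ≤ j := by exact_mod_cast hij.le
      simp only [hJdef]
      nlinarith
    · simp [hJdef, hI.idle i hi]
  have hJc : ∑' i, jobCost α (u i) (J i) =
      ENNReal.ofReal ((1 - δ) ^ (1 - α)) * ∑' i, jobCost α (u i) (I i) := by
    rw [← ENNReal.tsum_mul_left]
    refine tsum_congr fun i => ?_
    have : (J i).2 - (J i).1 = (1 - δ) * ((I i).2 - (I i).1) := by simp only [hJdef]; ring
    rw [jobCost, jobCost, this, ENNReal.ofReal_mul hδ.le,
      ENNReal.mul_rpow_of_ne_top ENNReal.ofReal_ne_top ENNReal.ofReal_ne_top,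
      ENNReal.ofReal_rpow_of_pos hδ]
    ring
  rw [add_zero]
  refine le_trans ?_ (mul_le_mul_right hc _)
  rw [← hJc]
  by_cases hfin : ∑' i, jobCost α (u i) (J i) = ∞
  · rw [hfin]; exact le_top
  · exact (OPT_le_cost (hJ.feasible hα hfin)).trans (hJ.cost_le hα hfin)

theorem cost_mono {α : ℝ} (hα : 0 ≤ α) {s s' : Schedule} (h : ∀ i t, s i t ≤ s' i t) :
    cost α s ≤ cost α s' :=
  lintegral_mono fun t => ENNReal.rpow_le_rpow (ENNReal.tsum_le_tsum fun i => h i t) hα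

theorem cost_add_le {α θ : ℝ} (hα : 1 < α) (h0 : 0 < θ) (h1 : θ < 1) {s s' : Schedule}
    (hs : ∀ i, Measurable (s i)) :
    cost α (fun i t => s i t + s' i t) ≤ ENNReal.ofReal ((1 - θ) ^ (1 - α)) * cost α s +
      ENNReal.ofReal (θ ^ (1 - α)) * cost α s' := by
  unfold cost
  rw [← lintegral_const_mul _ ((Measurable.tsum hs).pow_const α),
    ← lintegral_const_mul' _ _ ENNReal.ofReal_ne_top, ← lintegral_add_left
    (((Measurable.tsum hs).pow_const α).const_mul _)]
  refine lintegral_mono fun t => ?_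
  rw [ENNReal.tsum_add]
  exact add_rpow_le hα h0 h1 _ _

/-! ### Average Rate on the prediction error -/

/-- At almost every time at most D jobs run, and D^(α - 1) cancels the D in ((1 - δ) D)^(1 - α), so
the bound is free of D. -/
theorem cost_avr_shorten_le {α δ : ℝ} {D : ℕ} (hα : 1 < α) (hD : 0 < D) (h0 : 0 ≤ δ)
    (h1 : δ < 1) (w : Workload) :
    cost α (avr ((1 - δ) * D) w) ≤
      ENNReal.ofReal ((1 - δ) ^ (1 - α)) * ∑' i, (w i : ℝ≥0∞) ^ α := by
  have hδ : 0 < 1 - δ := by linarith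
  have hD' : (0 : ℝ) < D := by exact_mod_cast hD
  refine (cost_avr_le hα (mul_pos hδ hD') (N := D) (by nlinarith) w).trans (le_of_eq ?_)
  congr 1
  rw [ENNReal.ofReal_mul hδ.le, ENNReal.mul_rpow_of_ne_top ENNReal.ofReal_ne_top
    ENNReal.ofReal_ne_top, ENNReal.ofReal_rpow_of_pos hδ, ENNReal.ofReal_natCast,
    mul_left_comm, ← ENNReal.rpow_add _ _ (by simpa using hD.ne') (ENNReal.natCast_ne_top D)]
  simp

theorem coe_tsub_rpow_le {α : ℝ} (hα : 0 ≤ α) (x y : ℝ≥0) :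
    ((x - y : ℝ≥0) : ℝ≥0∞) ^ α ≤ ENNReal.ofReal (|(x : ℝ) - y| ^ α) := by
  rw [← ENNReal.ofReal_rpow_of_nonneg (abs_nonneg _) hα]
  refine ENNReal.rpow_le_rpow ?_ hα
  rw [← ENNReal.ofReal_coe_nnreal, NNReal.coe_sub_def]
  exact ENNReal.ofReal_le_ofReal (max_le (le_abs_self _) (abs_nonneg _))

theorem JobFeasible.const_mul {D : ℝ} {i : ℤ} {v : ℝ≥0} {f : ℝ → ℝ≥0∞}
    (hf : JobFeasible D i v f) (c : ℝ≥0) : JobFeasible D i (c * v) fun t => c * f t where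
  measurable := hf.measurable.const_mul _
  finite t := ENNReal.mul_ne_top ENNReal.coe_ne_top (hf.finite t)
  window t ht := by rw [hf.window t ht, mul_zero]
  work := by rw [lintegral_const_mul _ hf.measurable, hf.work, ENNReal.coe_mul]

/-- The optimum is stable under changes of the workload. -/
theorem OPT_le_of_error {α θ : ℝ} {D : ℕ} (hα : 1 < α) (hD : 0 < D) (h0 : 0 < θ) (h1 : θ < 1)
    (w u : Workload) :
    OPT α D u ≤ ENNReal.ofReal ((1 - θ) ^ (1 - α)) * OPT α D w +
      ENNReal.ofReal (θ ^ (1 - α)) * ∑' i, ENNReal.ofReal (|(w i : ℝ) - u i| ^ α) := by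
  have hD' : (0 : ℝ) < D := by exact_mod_cast hD
  refine le_mul_OPT_add (by simpa using Real.rpow_pos_of_pos (sub_pos.2 h1) _)
    ENNReal.ofReal_ne_top fun s hs => ?_
  have hs' := feasible_iff.1 hs
  -- A schedule of `w` is slowed down to process min (u i) (w i); the missing u i - w i is run by
  -- Average Rate. For w i = 0 the quotient is 0 by convention, as needed.
  set c : ℤ → ℝ≥0 := fun i => min (u i) (w i) / w i with hc
  have hc1 : ∀ i, c i ≤ 1 := fun i => div_le_one_of_le₀ (min_le_right _ _) zero_le
  have hfeas : Feasible D u fun i t => c i * s i t + avr D (fun j => u j - w j) i t := by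
    refine feasible_iff.2 fun i => ?_
    have h := ((hs' i).const_mul (c i)).add (jobFeasible_avr hD' i fun j => u j - w j)
    convert h using 1
    simp only [hc]
    by_cases hw : w i = 0
    · simp [hw]
    · rw [div_mul_cancel₀ _ hw]
      rcases le_total (u i) (w i) with hle | hle
      · simp [hle, tsub_eq_zero_of_le hle]
      · simp [hle]
  refine (OPT_le_cost hfeas).trans ((cost_add_le hα h0 h1 fun i =>
    (hs.measurable i).const_mul _).trans (add_le_add ?_ ?_))
  · gcongr
    refine cost_mono (by linarith) fun i t => ?_
    calc (c i : ℝ≥0∞) * s i t ≤ 1 * s i t := by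
          gcongr; exact_mod_cast hc1 i
      _ = s i t := one_mul _
  · gcongr
    have h := cost_avr_shorten_le hα hD le_rfl zero_lt_one fun j => u j - w j
    simp only [sub_zero, one_mul, Real.one_rpow, ENNReal.ofReal_one] at h
    refine h.trans (ENNReal.tsum_le_tsum fun i => ?_)
    rw [abs_sub_comm]
    exact coe_tsub_rpow_le (by linarith) _ _

/-! ### Robustification -/

theorem robustify_apply (δ D : ℝ) (s : Schedule) (i : ℤ) (t : ℝ) :
    robustify δ D s i t =
      (∫⁻ r in Icc (t - δ * D) (t + 0), s i r) / ENNReal.ofReal (δ * D + 0) := by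
  rw [robustify, setLIntegral_congr Ioc_ae_eq_Icc, add_zero, add_zero]

theorem jobFeasible_robustify {δ D D' : ℝ} (hc : 0 < δ * D) {s : Schedule} {i : ℤ} {v : ℝ≥0}
    (hs : JobFeasible D' i v (s i)) : JobFeasible (D' + δ * D) i v (robustify δ D s i) := by
  have hc0 : ENNReal.ofReal (δ * D + 0) ≠ 0 := by simpa using hc
  refine ⟨?_, fun t => ?_, fun t ht => ?_, ?_⟩
  · simp_rw [funext (robustify_apply δ D s i), div_eq_mul_inv]
    exact (measurable_setLIntegral_window _ _ hs.measurable).mul_const _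
  · rw [robustify_apply]
    refine ENNReal.div_ne_top (ne_top_of_le_ne_top ?_ (setLIntegral_le_lintegral _ _)) hc0
    rw [hs.work]; exact ENNReal.coe_ne_top
  · rw [robustify, setLIntegral_eq_zero measurableSet_Ioc, ENNReal.zero_div]
    refine fun r hr => hs.window r fun hr' => ht ⟨?_, ?_⟩
    · linarith [hr.2, hr'.1]
    · linarith [hr.1, hr'.2]
  · simp_rw [robustify_apply, div_eq_mul_inv]
    rw [lintegral_mul_const _ (measurable_setLIntegral_window _ _ hs.measurable),
      lintegral_setLIntegral_window _ _ hs.measurable, mul_comm, ← mul_assoc,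
      ENNReal.inv_mul_cancel hc0 ENNReal.ofReal_ne_top, one_mul, hs.work]

/-- Averaging commutes with summing over jobs, so Jensen applies to the total speed. -/
theorem cost_robustify_le {α δ D : ℝ} (hα : 1 < α) (hc : 0 < δ * D) {s : Schedule}
    (hs : ∀ i, Measurable (s i)) : cost α (robustify δ D s) ≤ cost α s := by
  refine le_trans (le_of_eq ?_)
    (lintegral_rpow_window_le (p := δ * D) (q := 0) hα (by linarith) (Measurable.tsum hs))
  refine lintegral_congr fun t => ?_
  simp_rw [robustify_apply, div_eq_mul_inv]
  rw [ENNReal.tsum_mul_right, lintegral_tsum fun i => (hs i).aemeasurable]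

/-! ### The algorithm LAS -/

/-- The speed is nonzero on the whole closed interval, endpoints included, so the interval lies in
the window; a degenerate one would have speed ∞, against `finite`. -/
theorem Feasible.uniform_mem {D : ℝ} {u : Workload} {I : Intervals}
    (h : Feasible D u (uniformSchedule u I)) {i : ℤ} (hle : (I i).1 ≤ (I i).2) (hi : u i ≠ 0) :
    (I i).1 < (I i).2 ∧ i ≤ (I i).1 ∧ (I i).2 ≤ i + D := by
  have hne : ∀ t ∈ Icc (I i).1 (I i).2, uniformSchedule u I i t ≠ 0 := fun t ht => by
    rw [uniformSchedule, indicator_of_mem ht]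
    exact (ENNReal.div_pos (by simpa using hi) ENNReal.ofReal_ne_top).ne'
  have hw : ∀ t ∈ Icc (I i).1 (I i).2, t ∈ Icc (i : ℝ) (i + D) := fun t ht => by
    by_contra hn
    exact hne t ht (h.window i t hn)
  refine ⟨lt_of_le_of_ne hle fun heq => h.finite i (I i).1 ?_, (hw _ ⟨le_rfl, hle⟩).1,
    (hw _ ⟨hle, le_rfl⟩).2⟩
  rw [uniformSchedule, indicator_of_mem (by exact ⟨le_rfl, hle⟩), heq, sub_self,
    ENNReal.ofReal_zero]
  exact ENNReal.div_zero (by simpa using hi)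

/-- This form separates the part dominated by the optimal schedule of `u` from the part controlled
by the prediction error. -/
theorem lasTrust_eq_add_avr (D : ℝ) (w u : Workload) (I : Intervals) (i : ℤ) (t : ℝ) :
    lasTrust D w u I i t = uniformSchedule (fun j => min (w j) (u j)) I i t +
      avr D (fun j => w j - u j) i t := by
  have hmono : Monotone fun x : ℝ≥0∞ => x / ENNReal.ofReal ((I i).2 - (I i).1) :=
    fun _ _ h => ENNReal.div_le_div_right h _
  rw [lasTrust, uniformSchedule, ENNReal.coe_min, ← hmono.map_min]
  rfl

theorem jobFeasible_lasTrust {D : ℝ} (hD : 0 < D) (w : Workload) {u : Workload}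
    {I : Intervals} (hle : ∀ i, (I i).1 ≤ (I i).2) (hI : Feasible D u (uniformSchedule u I))
    (i : ℤ) : JobFeasible D i (w i) (lasTrust D w u I i) := by
  have h1 : JobFeasible D i (min (w i) (u i))
      (uniformSchedule (fun j => min (w j) (u j)) I i) := by
    by_cases hi : u i = 0
    · rw [hi, min_eq_right zero_le]
      exact jobFeasible_zero D i fun t => by simp [uniformSchedule, hi]
    · obtain ⟨hab, ha, hb⟩ := hI.uniform_mem (hle i) hi
      exact jobFeasible_indicator hab ha hb _
  have h := h1.add (jobFeasible_avr hD i fun j => w j - u j)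
  rw [show min (w i) (u i) + (w i - u i) = w i by
    rcases le_total (w i) (u i) with h | h
    · simp [h, tsub_eq_zero_of_le h]
    · simp [h]] at h
  rwa [funext (lasTrust_eq_add_avr D w u I i)]

theorem jobFeasible_las {α δ : ℝ} {D : ℕ} (hD : 0 < D) (h0 : 0 < δ) (h1 : δ < 1)
    {solver : Workload → Intervals} (hsol : IsOfflineSolver α ((1 - δ) * D) solver)
    (w : Workload) {u : Workload} (hu : u.support.Finite) (i : ℤ) :
    JobFeasible D i (w i) (las solver δ D w u i) := by
  have hD' : (0 : ℝ) < D := by exact_mod_cast hD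
  have hδ : 0 < 1 - δ := by linarith
  have h := jobFeasible_robustify (mul_pos h0 hD')
    (jobFeasible_lasTrust (mul_pos hδ hD') w (hsol u hu).le (hsol u hu).feasible i)
  rwa [show (1 - δ) * (D : ℝ) + δ * D = D by ring] at h

theorem las_eq_zero (solver : Workload → Intervals) (δ D : ℝ) {w u : Workload} {i : ℤ}
    (hw : w i = 0) (hu : u i = 0) (t : ℝ) : las solver δ D w u i t = 0 := by
  have : ∀ r, lasTrust ((1 - δ) * D) w u (solver u) i r = 0 := fun r => by
    simp [lasTrust, hw, hu]
  simp [las, robustify, this]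

theorem cost_las_le {α δ : ℝ} {D : ℕ} (hα : 1 < α) (hD : 0 < D) (h0 : 0 < δ) (h1 : δ < 1)
    {solver : Workload → Intervals} (hsol : IsOfflineSolver α ((1 - δ) * D) solver)
    (w : Workload) {u : Workload} (hu : u.support.Finite) {P Q : ℝ≥0∞}
    (hP : P = ENNReal.ofReal ((1 - δ) ^ (1 - α))) (hQ : Q = ENNReal.ofReal (δ ^ (1 - α))) :
    cost α (las solver δ D w u) ≤ P ^ 3 * OPT α D w +
      (P ^ 2 * Q + P * Q) * ∑' i, ENNReal.ofReal (|(w i : ℝ) - u i| ^ α) := by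
  have hD' : (0 : ℝ) < D := by exact_mod_cast hD
  have hδ : 0 < 1 - δ := by linarith
  obtain ⟨hle, -, hfeas, hopt⟩ := hsol u hu
  set E := ∑' i, ENNReal.ofReal (|(w i : ℝ) - u i| ^ α)
  have hmeas : ∀ i, Measurable (uniformSchedule (fun j => min (w j) (u j)) (solver u) i) :=
    fun i => measurable_const.indicator measurableSet_Icc
  calc cost α (las solver δ D w u)
      ≤ cost α (lasTrust ((1 - δ) * D) w u (solver u)) :=
        cost_robustify_le hα (mul_pos h0 hD') fun i =>
          (jobFeasible_lasTrust (mul_pos hδ hD') w hle hfeas i).measurable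
    _ = cost α fun i t => uniformSchedule (fun j => min (w j) (u j)) (solver u) i t +
          avr ((1 - δ) * D) (fun j => w j - u j) i t := by
        simp_rw [cost, lasTrust_eq_add_avr]
    _ ≤ P * cost α (uniformSchedule (fun j => min (w j) (u j)) (solver u)) +
          Q * cost α (avr ((1 - δ) * D) fun j => w j - u j) := by
        rw [hP, hQ]; exact cost_add_le hα h0 h1 hmeas
    _ ≤ P * (P * (P * OPT α D w + Q * E)) + Q * (P * E) := by
        gcongr
        · calc cost α (uniformSchedule (fun j => min (w j) (u j)) (solver u))
              ≤ cost α (uniformSchedule u (solver u)) := by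
                refine cost_mono (by linarith) fun i t => indicator_le_indicator ?_
                gcongr
                exact min_le_right _ _
            _ = OPT α ((1 - δ) * D) u := hopt
            _ ≤ P * OPT α D u := by rw [hP]; exact OPT_shorten_le hα hD' h0 h1 hu
            _ ≤ _ := by
                gcongr
                rw [hP, hQ]; exact OPT_le_of_error hα hD h0 h1 w u
        · refine (cost_avr_shorten_le hα hD h0.le h1 _).trans ?_
          rw [hP]
          gcongr
          refine ENNReal.tsum_le_tsum fun i => ?_
          exact coe_tsub_rpow_le (by linarith) _ _
    _ = _ := by ring

/-! ### Splitting along disjoint sets of jobs -/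

open scoped Function

theorem tsum_indicator_le {ι κ : Type*} {A : κ → Set ι} (hA : Pairwise (Disjoint on A))
    (f : ι → ℝ≥0∞) (i : ι) : ∑' j, (A j).indicator f i ≤ f i := by
  by_cases h : ∃ j, i ∈ A j
  · obtain ⟨j, hj⟩ := h
    rw [tsum_eq_single j fun j' hj' =>
      indicator_of_notMem (fun hi => disjoint_left.1 (hA hj') hi hj) _]
    exact indicator_le_self _ _ _
  · push Not at h
    simp [h]

/-- Splitting a schedule along disjoint sets of jobs does not increase the total cost. -/
theorem tsum_cost_indicator_le {κ : Type*} [Countable κ] {α : ℝ} (hα : 1 ≤ α) {A : κ → Set ℤ}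
    (hA : Pairwise (Disjoint on A)) {s : Schedule} (hs : ∀ i, Measurable (s i)) :
    ∑' j, cost α (fun i t => (A j).indicator (fun i => s i t) i) ≤ cost α s := by
  have hm : ∀ j i, Measurable fun t => (A j).indicator (fun i => s i t) i := fun j i => by
    by_cases h : i ∈ A j
    · simpa [h] using hs i
    · simp [h]
  unfold cost
  rw [← lintegral_tsum fun j => ((Measurable.tsum (hm j)).pow_const α).aemeasurable]
  refine lintegral_mono fun t => (tsum_rpow_le_rpow_tsum hα _).trans
    (ENNReal.rpow_le_rpow ?_ (by linarith))
  rw [ENNReal.tsum_comm]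
  exact ENNReal.tsum_le_tsum fun i => tsum_indicator_le hA _ i

theorem tsum_OPT_restrict_le {κ : Type*} [Countable κ] {α D : ℝ} (hα : 1 ≤ α) {A : κ → Set ℤ}
    (hA : Pairwise (Disjoint on A)) (w : Workload) :
    ∑' j, OPT α D (restrict (A j) w) ≤ OPT α D w := by
  refine le_OPT fun s hs => le_trans (ENNReal.tsum_le_tsum fun j => OPT_le_cost ?_)
    (tsum_cost_indicator_le hα hA hs.measurable)
  refine feasible_iff.2 fun i => ?_
  by_cases h : i ∈ A j
  · simpa [restrict, h] using feasible_iff.1 hs i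
  · rw [restrict, indicator_of_notMem h]
    exact jobFeasible_zero D i fun t => by simp [h]

theorem avr_restrict (D : ℝ) (S : Set ℤ) (w : Workload) :
    avr D (restrict S w) = fun i t => S.indicator (fun i => avr D w i t) i := by
  funext i t
  by_cases h : i ∈ S <;> simp [avr, restrict, h]

/-! ### Blocks -/

theorem blockStart_add_one {D k : ℕ} (x : ℕ) (m : ℤ) :
    blockStart D k x (m + 1) = blockStart D k x m + 2 * k * D := by
  unfold blockStart; ring

theorem blockStart_strictMono {D k : ℕ} (hD : 0 < D) (hk : 0 < k) (x : ℕ) : StrictMono (blockStart D k x) := by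
  refine strictMono_int_of_lt_succ fun m => ?_
  rw [blockStart_add_one]
  have : (0 : ℤ) < 2 * k * D := by positivity
  linarith

theorem eq_of_mem_block {D k : ℕ} (hD : 0 < D) (hk : 0 < k) (x : ℕ) {m m' : ℤ} {t : ℝ} (h1 : blockStart D k x m ≤ t)
    (h2 : t < blockStart D k x (m + 1)) (h1' : blockStart D k x m' ≤ t)
    (h2' : t < blockStart D k x (m' + 1)) : m = m' := by
  have hlt : ∀ {a b : ℤ}, (blockStart D k x a : ℝ) ≤ t → t < blockStart D k x (b + 1) →
      a ≤ b := fun {a b} ha hb => by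
    have : blockStart D k x a < blockStart D k x (b + 1) := by exact_mod_cast ha.trans_lt hb
    exact Int.lt_add_one_iff.1 ((blockStart_strictMono hD hk x).lt_iff_lt.1 this)
  exact le_antisymm (hlt h1 h2') (hlt h1' h2)

theorem exists_mem_block {D k : ℕ} (hD : 0 < D) (hk : 0 < k) (x : ℕ) (i : ℤ) :
    ∃ m, blockStart D k x m ≤ i ∧ i < blockStart D k x (m + 1) := by
  have hpos : (0 : ℤ) < 2 * k * D := by positivity
  -- Obtained by solving 2((m - 1)k - x)D ≤ i for the largest m.
  refine ⟨(i + 2 * x * D) / (2 * k * D) + 1, ?_, ?_⟩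
  · have := Int.mul_ediv_self_le (x := i + 2 * x * D) (k := 2 * k * D) hpos.ne'
    unfold blockStart
    linarith
  · have := Int.lt_mul_ediv_self_add (x := i + 2 * x * D) (k := 2 * k * D) hpos
    unfold blockStart
    linarith

theorem mem_block_of_mem_boundaryJobs {D k : ℕ} (hk : 0 < k) (x : ℕ) {m i : ℤ} (h : i ∈ boundaryJobs D k x m) :
    blockStart D k x m ≤ i ∧ i < blockStart D k x (m + 1) := by
  refine ⟨?_, h.1⟩
  have h2 : blockStart D k x (m + 1) ≤ i + D := h.2
  rw [blockStart_add_one] at h2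
  have : (1 : ℤ) ≤ k := by exact_mod_cast hk
  nlinarith

theorem eq_of_mem_block_int {D k : ℕ} (hD : 0 < D) (hk : 0 < k) (x : ℕ) {m m' i : ℤ}
    (h : blockStart D k x m ≤ i ∧ i < blockStart D k x (m + 1))
    (h' : blockStart D k x m' ≤ i ∧ i < blockStart D k x (m' + 1)) : m = m' :=
  eq_of_mem_block hD hk x (t := i) (by exact_mod_cast h.1) (by exact_mod_cast h.2)
    (by exact_mod_cast h'.1) (by exact_mod_cast h'.2)

theorem mem_block_of_mem_innerJobs {D k : ℕ} (x : ℕ) {m i : ℤ} (h : i ∈ innerJobs D k x m) :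
    blockStart D k x m ≤ i ∧ i < blockStart D k x (m + 1) :=
  ⟨h.1, by have := h.2; omega⟩

theorem finite_innerJobs {D k : ℕ} (x : ℕ) (m : ℤ) : (innerJobs D k x m).Finite :=
  (finite_Ico (blockStart D k x m) (blockStart D k x (m + 1))).subset
    fun _ h => mem_block_of_mem_innerJobs x h

theorem pairwise_disjoint_innerJobs {D k : ℕ} (hD : 0 < D) (hk : 0 < k) (x : ℕ) : Pairwise (Disjoint on innerJobs D k x) :=
  fun _ _ hne => disjoint_left.2 fun _ h h' => hne (eq_of_mem_block_int hD hk x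
    (mem_block_of_mem_innerJobs x h) (mem_block_of_mem_innerJobs x h'))

/-- Boundary jobs of different offsets are disjoint. -/
theorem eq_of_mem_boundaryJobs {D k : ℕ} (hD : 0 < D) {x x' : ℕ} (hx : x < k) (hx' : x' < k) {m m' i : ℤ}
    (h : i ∈ boundaryJobs D k x m) (h' : i ∈ boundaryJobs D k x' m') : x = x' ∧ m = m' := by
  obtain ⟨h1, h2⟩ := h
  obtain ⟨h3, h4⟩ := h'
  have hs : ∀ (x : ℕ) (m : ℤ), blockStart D k x (m + 1) = 2 * (m * k - x) * D := fun x m => by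
    unfold blockStart; ring
  rw [hs] at h1 h2 h3 h4
  have hD' : (0 : ℤ) < D := by exact_mod_cast hD
  -- Both boundaries lie in (i, i + D] and are multiples of 2D, hence equal. Then 0 ≤ x, x' < k
  -- makes the representation mk - x unique.
  have key : m * k - x = m' * k - x' := by
    have ha : 2 * (m * k - x) - 2 * (m' * k - x') < (1 : ℤ) := by
      by_contra hcon
      nlinarith
    have hb : 2 * (m' * k - x') - 2 * (m * k - x) < (1 : ℤ) := by
      by_contra hcon
      nlinarith
    omega
  have hxk : (x : ℤ) < k := by exact_mod_cast hx
  have hxk' : (x' : ℤ) < k := by exact_mod_cast hx'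
  have hm : m = m' := by
    rcases lt_trichotomy m m' with hlt | heq | hlt
    · nlinarith
    · exact heq
    · nlinarith
  subst hm
  exact ⟨by omega, rfl⟩

/-! ### Feasibility and cost of the splitting algorithm -/

theorem support_restrict_finite {S : Set ℤ} (hS : S.Finite) (u : Workload) :
    (restrict S u).support.Finite := hS.subset fun _ hi => mem_of_indicator_ne_zero hi

theorem restrict_of_notMem {S : Set ℤ} (w : Workload) {i : ℤ} (hi : i ∉ S) :
    restrict S w i = 0 := indicator_of_notMem hi w

theorem algBlock_eq_zero (solver : Workload → Intervals) (δ : ℝ) {D k x : ℕ} (w : Workload)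
    (pred : ℤ → Workload) {m i : ℤ} (hi : i ∉ innerJobs D k x m) (t : ℝ) :
    algBlock solver δ D k x w pred m i t = 0 :=
  las_eq_zero solver δ D (restrict_of_notMem w hi) (restrict_of_notMem _ hi) t

theorem avrBlock_eq_zero {D k x : ℕ} (w : Workload) {m i : ℤ}
    (hi : i ∉ boundaryJobs D k x m) (t : ℝ) : avrBlock D k x w m i t = 0 := by
  simp [avrBlock, avr_restrict, hi]

theorem jobFeasible_algBlock {α δ : ℝ} {D k : ℕ} (hD : 0 < D) (h0 : 0 < δ)
    (h1 : δ < 1) {solver : Workload → Intervals} (hsol : IsOfflineSolver α ((1 - δ) * D) solver)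
    (x : ℕ) (w : Workload) (pred : ℤ → Workload) (m i : ℤ) :
    JobFeasible D i (restrict (innerJobs D k x m) w i) (algBlock solver δ D k x w pred m i) :=
  jobFeasible_las hD h0 h1 hsol _ (support_restrict_finite (finite_innerJobs x m) _) i

theorem feasible_splitting {α δ : ℝ} {D k : ℕ} (hD : 0 < D) (hk : 0 < k) (h0 : 0 < δ)
    (h1 : δ < 1) {solver : Workload → Intervals} (hsol : IsOfflineSolver α ((1 - δ) * D) solver)
    (x : ℕ) (w : Workload) (pred : ℤ → Workload) :
    Feasible D w (splitting solver δ D k x w pred) := by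
  refine feasible_iff.2 fun i => ?_
  obtain ⟨m, hm⟩ := exists_mem_block hD hk x i
  have hs : splitting solver δ D k x w pred i =
      fun t => algBlock solver δ D k x w pred m i t + avrBlock D k x w m i t := by
    funext t
    refine tsum_eq_single m fun m' hm' => ?_
    rw [algBlock_eq_zero solver δ w pred (fun h => hm' (eq_of_mem_block_int hD hk x
      (mem_block_of_mem_innerJobs x h) hm)) t, avrBlock_eq_zero w (fun h => hm'
      (eq_of_mem_block_int hD hk x (mem_block_of_mem_boundaryJobs hk x h) hm)) t, add_zero]
  have h := (jobFeasible_algBlock (k := k) hD h0 h1 hsol x w pred m i).add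
    (jobFeasible_avr (by exact_mod_cast hD) i (restrict (boundaryJobs D k x m) w))
  have hv : w i = restrict (innerJobs D k x m) w i + restrict (boundaryJobs D k x m) w i := by
    by_cases hb : blockStart D k x (m + 1) ≤ i + D
    · have hi : i ∉ innerJobs D k x m := fun h => absurd hb (not_le.2 h.2)
      have hi' : i ∈ boundaryJobs D k x m := ⟨hm.2, hb⟩
      simp [restrict, hi, hi']
    · have hi : i ∈ innerJobs D k x m := ⟨hm.1, not_le.1 hb⟩
      have hi' : i ∉ boundaryJobs D k x m := fun h => hb h.2
      simp [restrict, hi, hi']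
  rw [hs, hv]
  exact h

/-- All jobs that are scheduled by Average Rate for the offset `x`. -/
def allBoundaryJobs (D k x : ℕ) : Set ℤ := ⋃ m, boundaryJobs D k x m

theorem tsum_avrBlock_le {D k : ℕ} (hD : 0 < D) {x : ℕ} (hx : x < k) (w : Workload) (i : ℤ)
    (t : ℝ) :
    ∑' m, avrBlock D k x w m i t ≤ avr D (restrict (allBoundaryJobs D k x) w) i t := by
  have hdisj : Pairwise (Disjoint on boundaryJobs D k x) := fun m m' hne =>
    disjoint_left.2 fun i h h' => hne (eq_of_mem_boundaryJobs hD hx hx h h').2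
  by_cases hi : i ∈ allBoundaryJobs D k x
  · simp only [avrBlock, avr_restrict, indicator_of_mem hi]
    exact tsum_indicator_le hdisj (fun i => avr D w i t) i
  · rw [allBoundaryJobs, mem_iUnion, not_exists] at hi
    simp [avrBlock_eq_zero w (hi _)]

/-- The boundary sets of different offsets are disjoint, so a single run of Average Rate on all jobs
pays for all k of them. -/
theorem sum_cost_boundary_le {α : ℝ} {D k : ℕ} (hα : 1 < α) (hD : 0 < D) (w : Workload) :
    ∑ x ∈ Finset.range k, cost α (avr D (restrict (allBoundaryJobs D k x) w)) ≤
      2 ^ α * OPT α D w := by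
  have hD' : (0 : ℝ) < D := by exact_mod_cast hD
  have hdisj : Pairwise (Disjoint on fun x : Fin k => allBoundaryJobs D k x) :=
    fun x x' hne => disjoint_left.2 fun i h h' => by
      obtain ⟨m, hm⟩ := mem_iUnion.1 h
      obtain ⟨m', hm'⟩ := mem_iUnion.1 h'
      exact hne (Fin.ext (eq_of_mem_boundaryJobs hD x.2 x'.2 hm hm').1)
  rw [Finset.sum_range, ← tsum_fintype (L := .unconditional _)]
  simp_rw [avr_restrict]
  exact (tsum_cost_indicator_le hα.le hdisj fun i => (jobFeasible_avr hD' i w).measurable).trans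
    (cost_avr_le_OPT hα hD' w)

/-- The blocks are processed during disjoint intervals. -/
theorem cost_tsum_algBlock {α δ : ℝ} {D k : ℕ} (hα : 1 < α) (hD : 0 < D) (hk : 0 < k)
    (h0 : 0 < δ) (h1 : δ < 1) {solver : Workload → Intervals}
    (hsol : IsOfflineSolver α ((1 - δ) * D) solver) (x : ℕ) (w : Workload)
    (pred : ℤ → Workload) :
    cost α (fun i t => ∑' m, algBlock solver δ D k x w pred m i t) =
      ∑' m, cost α (algBlock solver δ D k x w pred m) := by
  have hf := fun m i => jobFeasible_algBlock (k := k) hD h0 h1 hsol x w pred m i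
  have hmem : ∀ (m : ℤ) (t : ℝ), ∑' i, algBlock solver δ D k x w pred m i t ≠ 0 →
      blockStart D k x m ≤ t ∧ t < blockStart D k x (m + 1) := by
    intro m t hne
    obtain ⟨i, hi⟩ : ∃ i, algBlock solver δ D k x w pred m i t ≠ 0 := by
      by_contra hcon
      push Not at hcon
      exact hne (by simp [hcon])
    have hin : i ∈ innerJobs D k x m := by
      by_contra hcon
      exact hi (algBlock_eq_zero solver δ w pred hcon t)
    have ht : t ∈ Icc (i : ℝ) (i + D) := by
      by_contra hcon
      exact hi ((hf m i).window t hcon)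
    have h2 : (blockStart D k x m : ℝ) ≤ i := by exact_mod_cast hin.1
    have h3 : (i : ℝ) + D < blockStart D k x (m + 1) := by exact_mod_cast hin.2
    exact ⟨h2.trans ht.1, ht.2.trans_lt h3⟩
  unfold cost
  rw [← lintegral_tsum fun m =>
    ((Measurable.tsum fun i => (hf m i).measurable).pow_const α).aemeasurable]
  refine lintegral_congr fun t => ?_
  rw [ENNReal.tsum_comm]
  exact rpow_tsum_of_subsingleton (by linarith) _ fun m m' hm hm' =>
    eq_of_mem_block hD hk x (hmem m t hm).1 (hmem m t hm).2 (hmem m' t hm').1 (hmem m' t hm').2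

/-- The error of the predictions that are used is controlled by the decayed error. -/
theorem tsum_block_error_le {α lam : ℝ} {D k : ℕ} (hα : 0 < α) (hD : 0 < D) (hk : 0 < k)
    (hl0 : 0 < lam) (hl1 : lam < 1) (x : ℕ) (w : Workload) (pred : ℤ → Workload) :
    ∑' m, ∑' i, ENNReal.ofReal (|(restrict (innerJobs D k x m) w i : ℝ) -
        restrict (innerJobs D k x m) (knowledge w pred (blockStart D k x m)) i| ^ α) ≤
      ENNReal.ofReal (lam ^ (-(2 * k * D : ℝ))) * evolvingError α lam w pred := by
  set e : ℤ → ℤ → ℝ≥0∞ := fun t i =>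
    ENNReal.ofReal (|(w i : ℝ) - pred t i| ^ α * lam ^ (i - t)) with he
  have hev : evolvingError α lam w pred = ∑' t, ∑' i, (Ioi t).indicator (e t) i := by
    unfold evolvingError
    exact tsum_congr fun t => tsum_subtype (Ioi t) (e t)
  rw [hev, ← ENNReal.tsum_mul_left]
  -- Different blocks start at different times, so the sum over blocks is part of the sum over all
  -- prediction times.
  refine le_trans (ENNReal.tsum_le_tsum fun m => ?_)
    (ENNReal.tsum_comp_le_tsum_of_injective (blockStart_strictMono hD hk x).injective _)
  rw [← ENNReal.tsum_mul_left]
  refine ENNReal.tsum_le_tsum fun i => ?_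
  by_cases hi : i ∈ innerJobs D k x m
  · simp only [restrict, indicator_of_mem hi]
    by_cases hlt : blockStart D k x m < i
    · rw [indicator_of_mem (by exact hlt), knowledge, if_neg (not_le.2 hlt),
        ← ENNReal.ofReal_mul (by positivity)]
      refine ENNReal.ofReal_le_ofReal ?_
      have hlen : ((i - blockStart D k x m : ℤ) : ℝ) ≤ 2 * k * D := by
        have := (mem_block_of_mem_innerJobs x hi).2
        rw [blockStart_add_one] at this
        have h2 : i - blockStart D k x m ≤ 2 * k * D := by linarith
        exact_mod_cast h2
      -- The job is released less than one block length after the prediction, so the prefactor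
      -- outweighs the decay.
      have h1 : 1 ≤ lam ^ (-(2 * k * D : ℝ)) * lam ^ (i - blockStart D k x m) := by
        rw [← Real.rpow_intCast, ← Real.rpow_add hl0]
        exact Real.one_le_rpow_of_pos_of_le_one_of_nonpos hl0 hl1.le (by linarith)
      have h2 : 0 ≤ |(w i : ℝ) - pred (blockStart D k x m) i| ^ α := by positivity
      nlinarith
    -- A job released at the block start is already known and contributes no error.
    · rw [knowledge, if_pos (not_lt.1 hlt)]
      simp [hα.ne']
  · simp [restrict, hi, hα.ne']

theorem cost_splitting_le {α δ lam : ℝ} {D k x : ℕ} (hα : 1 < α) (hD : 0 < D) (hk : 0 < k)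
    (hx : x < k) (h0 : 0 < δ) (h1 : δ < 1) {solver : Workload → Intervals}
    (hsol : IsOfflineSolver α ((1 - δ) * D) solver) (w : Workload) (pred : ℤ → Workload)
    (hl0 : 0 < lam) (hl1 : lam < 1) {P Q : ℝ≥0∞}
    (hP : P = ENNReal.ofReal ((1 - δ) ^ (1 - α))) (hQ : Q = ENNReal.ofReal (δ ^ (1 - α))) :
    cost α (splitting solver δ D k x w pred) ≤
      P * (P ^ 3 * OPT α D w + (P ^ 2 * Q + P * Q) *
        (ENNReal.ofReal (lam ^ (-(2 * k * D : ℝ))) * evolvingError α lam w pred)) +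
      Q * cost α (avr D (restrict (allBoundaryJobs D k x) w)) := by
  have hf := fun m i => jobFeasible_algBlock (k := k) hD h0 h1 hsol x w pred m i
  calc cost α (splitting solver δ D k x w pred)
      ≤ cost α fun i t => (∑' m, algBlock solver δ D k x w pred m i t) +
          avr D (restrict (allBoundaryJobs D k x) w) i t := by
        refine cost_mono (by linarith) fun i t => ?_
        rw [splitting, ENNReal.tsum_add]
        gcongr
        exact tsum_avrBlock_le hD hx w i t
    _ ≤ P * cost α (fun i t => ∑' m, algBlock solver δ D k x w pred m i t) +
          Q * cost α (avr D (restrict (allBoundaryJobs D k x) w)) := by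
        rw [hP, hQ]
        exact cost_add_le hα h0 h1 fun i => Measurable.tsum fun m => (hf m i).measurable
    _ ≤ _ := by
        gcongr
        rw [cost_tsum_algBlock hα hD hk h0 h1 hsol]
        refine (ENNReal.tsum_le_tsum fun m => cost_las_le hα hD h0 h1 hsol _
          (support_restrict_finite (finite_innerJobs x m) _) hP hQ).trans ?_
        rw [ENNReal.tsum_add, ENNReal.tsum_mul_left, ENNReal.tsum_mul_left]
        gcongr
        · exact tsum_OPT_restrict_le hα.le (pairwise_disjoint_innerJobs hD hk x) w
        · exact tsum_block_error_le (by linarith) hD hk hl0 hl1 x w pred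

theorem expectedCost_le {α δ lam : ℝ} {D k : ℕ} (hα : 1 < α) (hD : 0 < D) (hk : 0 < k)
    (h0 : 0 < δ) (h1 : δ < 1) {solver : Workload → Intervals}
    (hsol : IsOfflineSolver α ((1 - δ) * D) solver) (w : Workload) (pred : ℤ → Workload)
    (hl0 : 0 < lam) (hl1 : lam < 1) {p q : ℝ} (hp : p = (1 - δ) ^ (1 - α))
    (hq : q = δ ^ (1 - α)) :
    expectedCost α solver δ D k w pred ≤
      ENNReal.ofReal (p ^ 4 + q * 2 ^ α / k) * OPT α D w +
      ENNReal.ofReal ((p ^ 3 * q + p ^ 2 * q) * lam ^ (-(2 * k * D : ℝ))) *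
        evolvingError α lam w pred := by
  have hp0 : 0 ≤ p := by rw [hp]; exact Real.rpow_nonneg (by linarith) _
  have hq0 : 0 ≤ q := by rw [hq]; exact Real.rpow_nonneg h0.le _
  have hk0 : (k : ℝ≥0∞) ≠ 0 := by simpa using hk.ne'
  have hkt : (k : ℝ≥0∞) ≠ ∞ := ENNReal.natCast_ne_top k
  have hkr : (0 : ℝ) < k := by exact_mod_cast hk
  set P := ENNReal.ofReal p with hP
  set Q := ENNReal.ofReal q with hQ
  set O := OPT α D w
  set L := ENNReal.ofReal (lam ^ (-(2 * k * D : ℝ))) with hL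
  set E := evolvingError α lam w pred
  set M := P * (P ^ 3 * O + (P ^ 2 * Q + P * Q) * (L * E)) with hM
  have hsum : ∑ x ∈ Finset.range k, cost α (splitting solver δ D k x w pred) ≤
      k * M + Q * (2 ^ α * O) := by
    refine (Finset.sum_le_sum fun x hx => cost_splitting_le hα hD hk (Finset.mem_range.1 hx) h0
      h1 hsol w pred hl0 hl1 (P := P) (Q := Q) (by rw [hP, hp]) (by rw [hQ, hq])).trans ?_
    rw [Finset.sum_add_distrib, Finset.sum_const, Finset.card_range, nsmul_eq_mul,
      ← Finset.mul_sum]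
    gcongr
    exact sum_cost_boundary_le hα hD w
  have h2 : (2 : ℝ≥0∞) ^ α = ENNReal.ofReal (2 ^ α) := by
    rw [← ENNReal.ofReal_rpow_of_pos two_pos, ENNReal.ofReal_ofNat]
  have ha : ENNReal.ofReal (p ^ 4 + q * 2 ^ α / k) = P ^ 4 + Q * 2 ^ α / k := by
    rw [ENNReal.ofReal_add (by positivity) (by positivity), ENNReal.ofReal_pow hp0,
      ENNReal.ofReal_div_of_pos hkr, ENNReal.ofReal_mul hq0, h2, ENNReal.ofReal_natCast]
  have hb : ENNReal.ofReal ((p ^ 3 * q + p ^ 2 * q) * lam ^ (-(2 * k * D : ℝ))) =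
      (P ^ 3 * Q + P ^ 2 * Q) * L := by
    rw [ENNReal.ofReal_mul (by positivity), ENNReal.ofReal_add (by positivity) (by positivity),
      ENNReal.ofReal_mul (by positivity), ENNReal.ofReal_mul (by positivity),
      ENNReal.ofReal_pow hp0, ENNReal.ofReal_pow hp0]
  rw [ha, hb]
  calc expectedCost α solver δ D k w pred
      ≤ (k * M + Q * (2 ^ α * O)) / k := by
        unfold expectedCost
        gcongr
    _ = M + Q * 2 ^ α / k * O := by
        rw [ENNReal.add_div, mul_comm (k : ℝ≥0∞) M, ENNReal.mul_div_cancel_right hk0 hkt]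
        simp only [div_eq_mul_inv]
        ring
    _ = _ := by rw [hM]; ring

/-! ### Choice of δ and k -/

/-- The numerical bounds for `δ = ε / (16 * α)`. -/
theorem parameter_bounds {α ε : ℝ} (hα : 1 < α) (h0 : 0 < ε) (h1 : ε ≤ 1) {p q : ℝ} {k : ℕ}
    (hp : p = (1 - ε / (16 * α)) ^ (1 - α)) (hq : q = (ε / (16 * α)) ^ (1 - α))
    (hk : k = ⌈(32 * α / ε) ^ α / ε⌉₊) :
    0 < k ∧ p ^ 4 + q * 2 ^ α / k ≤ 1 + ε ∧
      p ^ 3 * q + p ^ 2 * q ≤ (128 * α / ε) ^ α ∧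
      2 * k ≤ (128 * α / ε) ^ α / ε := by
  have hα0 : 0 < α := by linarith
  have hδ0 : 0 < ε / (16 * α) := by positivity
  have hδα : ε / (16 * α) * α = ε / 16 := by field_simp
  have hδ1 : ε / (16 * α) ≤ 1 / 16 := by nlinarith
  set δ := ε / (16 * α) with hδ
  set B := (32 * α / ε) ^ α with hB
  have hbase : 1 ≤ 32 * α / ε := by rw [le_div_iff₀ h0]; linarith
  have hB1 : 1 ≤ B := Real.one_le_rpow hbase hα0.le
  have hp0 : 0 < p := by rw [hp]; exact Real.rpow_pos_of_pos (by linarith) _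
  have hq0 : 0 < q := by rw [hq]; exact Real.rpow_pos_of_pos hδ0 _
  have hkB : B / ε ≤ k := by rw [hk]; exact Nat.le_ceil _
  have hkB' : (k : ℝ) < B / ε + 1 := by rw [hk]; exact Nat.ceil_lt_add_one (by positivity)
  have hBε : 1 ≤ B / ε := by rw [le_div_iff₀ h0]; linarith
  have hkpos : (0 : ℝ) < k := by linarith
  -- Bernoulli bounds 1/p below by 1 - ε/16, and (1 + ε/15)(1 - ε/16) ≥ 1 for ε ≤ 1.
  have hp1 : p ≤ 1 + ε / 15 := by
    have hb : 1 - ε / 16 ≤ (1 - δ) ^ (α - 1) := by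
      calc 1 - ε / 16 = 1 + α * (-δ) := by rw [← hδα]; ring
        _ ≤ (1 + -δ) ^ α := one_add_mul_self_le_rpow_one_add (by linarith) hα.le
        _ ≤ (1 - δ) ^ (α - 1) := by
          rw [← sub_eq_add_neg]
          exact Real.rpow_le_rpow_of_exponent_ge (by linarith) (by linarith) (by linarith)
    have hinv : p * (1 - δ) ^ (α - 1) = 1 := by
      rw [hp, ← Real.rpow_add (by linarith)]; simp
    have hle : p * (1 - ε / 16) ≤ 1 :=
      (mul_le_mul_of_nonneg_left hb hp0.le).trans hinv.le
    have : 1 ≤ (1 + ε / 15) * (1 - ε / 16) := by nlinarith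
    by_contra hcon
    nlinarith
  have hp4 : p ^ 4 ≤ 1 + ε / 2 := by
    calc p ^ 4 ≤ (1 + ε / 15) ^ 4 := by gcongr
      _ ≤ (1 + ε / 7) ^ 2 := by
        rw [show (1 + ε / 15) ^ 4 = ((1 + ε / 15) ^ 2) ^ 2 by ring]
        gcongr
        nlinarith
      _ ≤ 1 + ε / 2 := by nlinarith
  -- Since 2/δ = 32α/ε, this is δ (2/δ)^α; with k ≥ B/ε the boundary term is at most δε.
  have hqB : q * 2 ^ α = B * δ := by
    have h1 : q = (16 * α / ε) ^ α * δ := by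
      have h2 : 16 * α / ε = δ⁻¹ := by rw [hδ, inv_div]
      rw [hq, Real.rpow_sub hδ0, Real.rpow_one, h2, Real.inv_rpow hδ0.le]
      ring
    rw [h1, hB, show 32 * α / ε = 16 * α / ε * 2 by ring, Real.mul_rpow (by positivity)
      zero_le_two]
    ring
  -- As α > 1, constant factors can be absorbed into the base; the factor 4 turns 32 into 128.
  have hBmul : ∀ c : ℝ, 1 ≤ c → c * B ≤ (c * (32 * α / ε)) ^ α := fun c hc => by
    rw [Real.mul_rpow (by linarith) (by positivity)]
    gcongr
    simpa using Real.rpow_le_rpow_of_exponent_le hc hα.le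
  have hB4 : 4 * B ≤ (128 * α / ε) ^ α := by
    have := hBmul 4 (by norm_num)
    rwa [show 4 * (32 * α / ε) = 128 * α / ε by ring] at this
  refine ⟨by exact_mod_cast hkpos, ?_, ?_, ?_⟩
  · have : q * 2 ^ α / k ≤ ε / 2 := by
      rw [div_le_iff₀ hkpos, hqB]
      calc B * δ ≤ B * (1 / 2) := by gcongr; linarith
        _ = ε / 2 * (B / ε) := by field_simp
        _ ≤ ε / 2 * k := by gcongr
    linarith
  · have h2 : (1 : ℝ) ≤ 2 ^ α := Real.one_le_rpow one_le_two hα0.le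
    have hqB' : q ≤ B := by nlinarith
    have hp2 : p ≤ 16 / 15 := by linarith
    have h3 : p ^ 3 ≤ (16 / 15) ^ 3 := by gcongr
    have h4 : p ^ 2 ≤ (16 / 15) ^ 2 := by gcongr
    nlinarith
  -- Rounding up is harmless: k < B/ε + 1 ≤ 2B/ε.
  · refine le_trans ?_ (div_le_div_of_nonneg_right hB4 h0.le)
    rw [mul_div_assoc]
    linarith

end SpeedScaling

theorem mainTheorem12 :
    ∃ C : ℝ, 0 < C ∧ ∀ α ε : ℝ, 1 < α → 0 < ε → ε ≤ 1 →
      ∃ (δ : ℝ) (k : ℕ), ε / (C * α) ≤ δ ∧ δ ≤ C * ε / α ∧ δ < 1 ∧ 0 < k ∧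
        ∀ D : ℕ, 0 < D →
          (∃ solver, SpeedScaling.IsOfflineSolver α ((1 - δ) * D) solver) ∧
          ∀ solver, SpeedScaling.IsOfflineSolver α ((1 - δ) * D) solver →
            ∀ (w : SpeedScaling.Workload) (pred : ℤ → SpeedScaling.Workload),
              (∀ x < k, SpeedScaling.Feasible D w
                (SpeedScaling.splitting solver δ D k x w pred)) ∧
              ∀ lam : ℝ, 0 < lam → lam < 1 →
                SpeedScaling.expectedCost α solver δ D k w pred ≤
                  ENNReal.ofReal (1 + ε) * SpeedScaling.OPT α D w +
                  ENNReal.ofReal ((C * α / ε) ^ α * lam ^ (-(D / ε * (C * α / ε) ^ α))) *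
                    SpeedScaling.evolvingError α lam w pred := by
  refine ⟨128, by norm_num, fun α ε hα hε0 hε1 => ?_⟩
  have hα0 : 0 < α := by linarith
  obtain ⟨hk, hOPT, hE, hlen⟩ :=
    SpeedScaling.parameter_bounds hα hε0 hε1 rfl rfl rfl
  have hδ0 : 0 < ε / (16 * α) := by positivity
  have hδ1 : ε / (16 * α) < 1 := by rw [div_lt_one (by positivity)]; linarith
  refine ⟨ε / (16 * α), ⌈(32 * α / ε) ^ α / ε⌉₊, by gcongr; norm_num, ?_, hδ1, hk,
    fun D hD => ?_⟩
  · rw [div_le_div_iff₀ (by positivity) hα0]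
    nlinarith [mul_pos hε0 hα0]
  have hD' : (0 : ℝ) < D := by exact_mod_cast hD
  refine ⟨SpeedScaling.exists_isOfflineSolver hα (mul_pos (by linarith) hD'),
    fun solver hsol w pred =>
    ⟨fun x _ => SpeedScaling.feasible_splitting hD hk hδ0 hδ1 hsol x w pred,
    fun lam hl0 hl1 => ?_⟩⟩
  refine (SpeedScaling.expectedCost_le hα hD hk hδ0 hδ1 hsol w pred hl0 hl1 rfl rfl).trans ?_
  gcongr ENNReal.ofReal ?_ * _ + ENNReal.ofReal ?_ * _
  refine mul_le_mul hE ?_ (by positivity) (by positivity)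
  -- For lam < 1 a smaller exponent gives a larger power, so it suffices to bound the block length
  -- 2kD.
  refine Real.rpow_le_rpow_of_exponent_ge hl0 hl1.le (neg_le_neg ?_)
  calc 2 * (⌈(32 * α / ε) ^ α / ε⌉₊ : ℝ) * D ≤ (128 * α / ε) ^ α / ε * D := by gcongr
    _ = D / ε * (128 * α / ε) ^ α := by ring
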